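/- Smooth manifolds are finite-dimensional, Hausdorff and paracompact; $\mathrm{SmthMfd}$ is their category. For a simplicial object $X$ and a simplicial set $K$, the matching object $M_KX$ is the limit $\varprojlim_{\Delta^m\to K}X_m$ over the (opposite of the) category of simplices of $K$. For a simplicial smooth manifold $X$ it always exists as a sheaf on $\mathrm{SmthMfd}$ ($X$ being identified with the simplicial sheaf it represents); it exists in $\mathrm{SmthMfd}$ when this sheaf is representable, and a map from a manifold to a sheaf is called a surjective submersion if the sheaf is representable and the corresponding smooth map is a surjective submersion. A morphism $f\colon X\to Y$ of simplicial smooth manifolds is a submersive local fibration if $f_0$ and all canonical maps $X_n\to Y_n\times_{M_{\Lambda^n_k}Y}M_{\Lambda^n_k}X$ ($n\ge 1$, $0\le k\le n$) are surjective submersions. $X$ is a Lie $\infty$-groupoid if $X\to *$ is a submersive local fibration and all face maps of $X$ are submersions. $X$ is locally fibrant if for every $m$ the simplicial set $[n]\mapsto \varinjlim_j C^\infty(D^m_j,X_n)$ is a Kan complex, where $D^m_j\subset\mathbb{R}^m$ is the open disk of radius $1/j$ around the origin (that is, the simplicial sheaf represented by $X$ is stalkwise a Kan complex). $\mathrm{Dec}_0X$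 denotes the décalage, i.e. precomposition of $X$ with $[n]\mapsto[n]\star[0]=[n+1]$, with its canonical map $d_{n+1}\colon(\mathrm{Dec}_0X)_n=X_{n+1}\to X_n$, and $X^{o}$ denotes the opposite simplicial object (reversal of the order of the vertices). **Proposition.** Let $G$ be a simplicial Lie group. Then $G$ is a Lie $\infty$-groupoid. In detail: 1. For all $n\ge1$ and $0\le k\le n$ the matching object $M_{\Lambda^n_k}G$ exists in $\mathrm{SmthMfd}$, and the canonical map $G_n\to M_{\Lambda^n_k}G$ is a surjective submersion; moreover all face maps of $G$ are submersions and $G_0\to *$ is a surjective submersion. 2. For $n\ge2$ and $0\le k<n$ the canonical square $$\begin{array}{ccc} M_{\Lambda^n_k}G&\longrightarrow& G_{n-1}\\ \downarrow&&\downarrow\\ M_{\Lambda^{n-1}_k}\mathrm{Dec}_0G&\longrightarrow& M_{\Lambda^{n-1}_k}G\end{array}$$ is a pullback in $\mathrm{SmthMfd}$ (the top map is the projection to the face opposite to the last vertex). For $n\ge 1$, $M_{\Lambda^n_n}G$ is isomorphic to $M_{\Lambda^n_0}G^{o}$, compatibly with the canonical maps from $G_n=G^{o}_n$. In particular, $G$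 is a locally fibrant simplicial smooth manifold. -/

import Mathlib

open CategoryTheory Limits Opposite Simplicial
open scoped Manifold ContDiff

universe u v w

noncomputable section

/-! ### Smooth manifolds and Lie groups -/

/-- A finite-dimensional smooth manifold: a paracompact Hausdorff space with a smooth atlas modelled
on `ℝ ^ dim`. -/
structure SmthMfd : Type (u + 1) where
  carrier : Type u
  dim : ℕ
  [top : TopologicalSpace carrier]
  [charted : ChartedSpace (EuclideanSpace ℝ (Fin dim)) carrier]
  [smooth : IsManifold (𝓡 dim) ∞ carrier]
  [t2 : T2Space carrier]
  [paracompact : ParacompactSpace carrier]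

namespace SmthMfd

attribute [instance] top charted smooth t2 paracompact

/-- The category of smooth manifolds and smooth maps. -/
instance : Category.{u} SmthMfd.{u} where
  Hom M N := ContMDiffMap (𝓡 M.dim) (𝓡 N.dim) M.carrier N.carrier ∞
  id _ := ContMDiffMap.id
  comp f g := ContMDiffMap.comp g f

/-- The function underlying a morphism of smooth manifolds. -/
def toFun {M N : SmthMfd.{u}} (f : M ⟶ N) : M.carrier → N.carrier :=
  f.1

/-- A submersion of smooth manifolds. -/
def IsSubmersion {M N : SmthMfd.{u}} (f : M ⟶ N) : Prop :=
  Manifold.IsSubmersion (𝓡 M.dim) (𝓡 N.dim) ∞ (toFun f)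

/-- A surjective submersion of smooth manifolds. -/
def IsSurjSubmersion {M N : SmthMfd.{u}} (f : M ⟶ N) : Prop :=
  Function.Surjective (toFun f) ∧ IsSubmersion f

instance pointChartedSpace : ChartedSpace (EuclideanSpace ℝ (Fin 0)) PUnit.{u + 1} :=
  ChartedSpace.ofDiscreteTopology

instance pointIsManifold : IsManifold (𝓡 0) ∞ PUnit.{u + 1} :=
  IsManifold.of_discreteTopology (E := EuclideanSpace ℝ (Fin 0)) ∞

/-- The point, as a smooth manifold. -/
def point : SmthMfd.{u} where
  carrier := PUnit.{u + 1}
  dim := 0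

/-- The map from a smooth manifold to the point. -/
def toPoint (M : SmthMfd.{u}) : M ⟶ point.{u} :=
  ContMDiffMap.const PUnit.unit

lemma hom_point_ext {M : SmthMfd.{u}} (f g : M ⟶ point.{u}) : f = g :=
  ContMDiffMap.ext fun _ => rfl

end SmthMfd

/-- A (finite-dimensional, real) Lie group. -/
structure LieGrp : Type (u + 1) extends SmthMfd.{u} where
  [group : Group carrier]
  [lieGroup : LieGroup (𝓡 dim) ∞ carrier]

namespace LieGrp

attribute [instance] group lieGroup

/-- The category of Lie groups and smooth homomorphisms. -/
instance : Category.{u} LieGrp.{u} where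
  Hom G H := ContMDiffMonoidMorphism (𝓡 G.dim) (𝓡 H.dim) ∞ G.carrier H.carrier
  id G := { MonoidHom.id G.carrier with contMDiff_toFun := contMDiff_id }
  comp f g := { g.toMonoidHom.comp f.toMonoidHom with
    contMDiff_toFun := g.contMDiff_toFun.comp f.contMDiff_toFun }

/-- The functor that sends a Lie group to its underlying smooth manifold. -/
def forgetToMfd : LieGrp.{u} ⥤ SmthMfd.{u} where
  obj G := G.toSmthMfd
  map f := ⟨f.toFun, f.contMDiff_toFun⟩

end LieGrp

/-- A simplicial Lie group is a simplicial object in the category of Lie groups. -/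
abbrev SimplicialLieGroup : Type (u + 1) := SimplicialObject LieGrp.{u}

/-- A simplicial smooth manifold is a simplicial object in the category of smooth manifolds. -/
abbrev SimplicialMfd : Type (u + 1) := SimplicialObject SmthMfd.{u}

/-- The simplicial smooth manifold underlying a simplicial Lie group. -/
def SimplicialLieGroup.toMfd (G : SimplicialLieGroup.{u}) : SimplicialMfd.{u} :=
  G ⋙ LieGrp.forgetToMfd

/-! ### Matching objects -/

section Matching

variable {C : Type w} [Category.{v} C]

/-- The diagram `(Δⁿ → K) ↦ Xₙ`, indexed by the opposite of the category of simplices of `K`. -/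
abbrev matchingDiagram (K : SSet.{0}) (X : SimplicialObject C) : K.Elements ⥤ C :=
  CategoryOfElements.π K ⋙ X

/-- A matching object of `X` at `K` in `C`: a limit of the matching diagram, with its
projections. -/
abbrev MatchingObject (K : SSet.{0}) (X : SimplicialObject C) :=
  LimitCone (matchingDiagram K X)

/-- For a simplicial subset `K ⊆ Δ[n]`, the restriction cone with apex `Xₙ`: its component at a
simplex `x : [m] → [n]` of `K` is `x^* : Xₙ ⟶ Xₘ`. -/
def simplexCone {n : ℕ} (K : (Δ[n] : SSet.{0}).Subcomplex) (X : SimplicialObject C) :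
    Cone (matchingDiagram (K : SSet.{0}) X) where
  pt := X _⦋n⦌
  π :=
    { app := fun x => X.map (SSet.stdSimplex.objEquiv x.2.1).op
      naturality := by
        intro x y f
        have h : SSet.stdSimplex.objEquiv y.2.1 = f.1.unop ≫ SSet.stdSimplex.objEquiv x.2.1 :=
          congrArg (fun z => SSet.stdSimplex.objEquiv (Subtype.val z)) f.2.symm
        rw [h]
        exact (Category.id_comp _).trans (X.map_comp (SSet.stdSimplex.objEquiv x.2.1).op f.1) }

/-- The canonical morphism `Xₙ ⟶ M_K X` for a simplicial subset `K ⊆ Δ[n]`. -/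
def MatchingObject.fromSimplex {n : ℕ} {K : (Δ[n] : SSet.{0}).Subcomplex}
    {X : SimplicialObject C} (M : MatchingObject (K : SSet.{0}) X) : X _⦋n⦌ ⟶ M.cone.pt :=
  M.isLimit.lift (simplexCone K X)

/-- The morphism `M_K X ⟶ M_K Y` induced by a morphism `X ⟶ Y`. -/
def MatchingObject.map {K : SSet.{0}} {X Y : SimplicialObject C} (M : MatchingObject K X)
    (N : MatchingObject K Y) (f : X ⟶ Y) : M.cone.pt ⟶ N.cone.pt :=
  N.isLimit.lift ((Cone.postcompose (Functor.whiskerLeft (CategoryOfElements.π K) f)).obj M.cone)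

lemma MatchingObject.fromSimplex_π {n : ℕ} {K : (Δ[n] : SSet.{0}).Subcomplex}
    {X : SimplicialObject C} (M : MatchingObject (K : SSet.{0}) X) (x : (K : SSet.{0}).Elements) :
    M.fromSimplex ≫ M.cone.π.app x = X.map (SSet.stdSimplex.objEquiv x.2.1).op :=
  M.isLimit.fac _ x

lemma MatchingObject.map_π {K : SSet.{0}} {X Y : SimplicialObject C} (M : MatchingObject K X)
    (N : MatchingObject K Y) (f : X ⟶ Y) (x : K.Elements) :
    M.map N f ≫ N.cone.π.app x = M.cone.π.app x ≫ f.app x.1 :=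
  N.isLimit.fac _ x

lemma MatchingObject.fromSimplex_map {n : ℕ} {K : (Δ[n] : SSet.{0}).Subcomplex}
    {X Y : SimplicialObject C} (M : MatchingObject (K : SSet.{0}) X)
    (N : MatchingObject (K : SSet.{0}) Y) (f : X ⟶ Y) :
    f.app (op ⦋n⦌) ≫ N.fromSimplex = M.fromSimplex ≫ M.map N f := by
  refine N.isLimit.hom_ext fun x => ?_
  rw [Category.assoc, Category.assoc, fromSimplex_π, map_π]
  refine (f.naturality (SSet.stdSimplex.objEquiv x.2.1).op).symm.trans ?_
  refine Eq.trans ?_ (Category.assoc M.fromSimplex (M.cone.π.app x) (f.app x.1))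
  exact congrArg (· ≫ f.app x.1) (M.fromSimplex_π x).symm

end Matching

/-! ### The simplicial sheaf represented by a simplicial manifold -/

/-- Presheaves of sets on smooth manifolds. -/
abbrev MfdPsh : Type (u + 1) := SmthMfd.{u}ᵒᵖ ⥤ Type u

/-- The simplicial presheaf (in fact, sheaf) represented by a simplicial manifold. -/
abbrev SimplicialMfd.toPsh (X : SimplicialMfd.{u}) : SimplicialObject MfdPsh.{u} :=
  ((SimplicialObject.whiskering _ _).obj yoneda).obj X

/-- The morphism of represented simplicial presheaves induced by a morphism of simplicial
manifolds. -/
abbrev SimplicialMfd.mapPsh {X Y : SimplicialMfd.{u}} (f : X ⟶ Y) :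
    SimplicialMfd.toPsh X ⟶ SimplicialMfd.toPsh Y :=
  ((SimplicialObject.whiskering _ _).obj yoneda).map f

/-- The matching object of the sheaf represented by a simplicial manifold, which always exists as a
sheaf. -/
def SimplicialMfd.matchingPsh (K : SSet.{0}) (X : SimplicialMfd.{u}) :
    MatchingObject K (SimplicialMfd.toPsh X) :=
  getLimitCone _

/-- For a morphism `f : X ⟶ Y` of simplicial manifolds and a simplicial subset `K ⊆ Δ[n]`, the
canonical morphism `Xₙ ⟶ Yₙ ×_{M_K Y} M_K X` of sheaves. -/
def SimplicialMfd.relMatchingMap {X Y : SimplicialMfd.{u}} (f : X ⟶ Y) {n : ℕ}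
    (K : (Δ[n] : SSet.{0}).Subcomplex) :
    yoneda.obj (X _⦋n⦌) ⟶
      pullback (SimplicialMfd.matchingPsh (K : SSet.{0}) Y).fromSimplex
        ((SimplicialMfd.matchingPsh (K : SSet.{0}) X).map
          (SimplicialMfd.matchingPsh (K : SSet.{0}) Y) (SimplicialMfd.mapPsh f)) :=
  pullback.lift (yoneda.map (f.app (op ⦋n⦌)))
    (SimplicialMfd.matchingPsh (K : SSet.{0}) X).fromSimplex
    (MatchingObject.fromSimplex_map _ _ (SimplicialMfd.mapPsh f))

/-- A morphism from a smooth manifold to a sheaf is a surjective submersion if the sheaf is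
representable by a smooth manifold and the corresponding smooth map is a surjective submersion. -/
def IsRepresentableSurjSubmersion {M : SmthMfd.{u}} {F : MfdPsh.{u}} (φ : yoneda.obj M ⟶ F) :
    Prop :=
  ∃ (N : SmthMfd.{u}) (e : yoneda.obj N ≅ F) (p : M ⟶ N),
    yoneda.map p ≫ e.hom = φ ∧ SmthMfd.IsSurjSubmersion p

/-! ### Lie ∞-groupoids -/

/-- A submersive local fibration of simplicial manifolds: `X₀ ⟶ Y₀` and all the relative horn maps
`Xₙ ⟶ Yₙ ×_{M_Λ Y} M_Λ X`, for the horns `Λ = Λ[n, k]` with `n ≥ 1` and `0 ≤ k ≤ n`, are surjective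
submersions. -/
def IsSubmersiveLocalFibration {X Y : SimplicialMfd.{u}} (f : X ⟶ Y) : Prop :=
  SmthMfd.IsSurjSubmersion (f.app (op ⦋0⦌)) ∧
    ∀ (n : ℕ) (k : Fin (n + 2)),
      IsRepresentableSurjSubmersion (SimplicialMfd.relMatchingMap f (SSet.horn.{0} (n + 1) k))

/-- The map from a simplicial manifold to the (constant simplicial) point. -/
def SimplicialMfd.toPoint (X : SimplicialMfd.{u}) :
    X ⟶ (SimplicialObject.const SmthMfd.{u}).obj SmthMfd.point.{u} where
  app n := SmthMfd.toPoint (X.obj n)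
  naturality _ _ _ := SmthMfd.hom_point_ext _ _

/-- A Lie ∞-groupoid is a simplicial manifold whose map to the point is a submersive local
fibration and whose face maps are submersions. -/
def IsLieInfinityGroupoid (X : SimplicialMfd.{u}) : Prop :=
  IsSubmersiveLocalFibration (SimplicialMfd.toPoint X) ∧
    ∀ (n : ℕ) (i : Fin (n + 2)), SmthMfd.IsSubmersion (X.δ i)

/-! ### Locally fibrant simplicial manifolds -/

/-- The open disk of radius `1 / (k + 1)` around the origin of `ℝⁿ` (in the universe `u`). -/
abbrev Disk (n k : ℕ) : Type u :=
  ULift.{u} (Metric.ball (0 : EuclideanSpace ℝ (Fin n)) (1 / ((k : ℝ) + 1)))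

namespace Disk

instance (n k : ℕ) : Nonempty (Disk.{u} n k) :=
  ⟨⟨⟨0, Metric.mem_ball_self (by positivity)⟩⟩⟩

/-- The inclusion of the disk in `ℝⁿ`. -/
def val {n k : ℕ} (x : Disk.{u} n k) : EuclideanSpace ℝ (Fin n) := x.down.1

lemma isOpenEmbedding_val (n k : ℕ) : Topology.IsOpenEmbedding (val : Disk.{u} n k → _) :=
  (Metric.isOpen_ball.isOpenEmbedding_subtypeVal).comp Homeomorph.ulift.isOpenEmbedding

instance (n k : ℕ) : ChartedSpace (EuclideanSpace ℝ (Fin n)) (Disk.{u} n k) :=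
  (isOpenEmbedding_val n k).singletonChartedSpace

instance (n k : ℕ) : IsManifold (𝓡 n) ∞ (Disk.{u} n k) :=
  (isOpenEmbedding_val n k).isManifold_singleton

instance (n k : ℕ) : ParacompactSpace (Disk.{u} n k) :=
  Homeomorph.ulift.isClosedEmbedding.paracompactSpace

/-- The disk of radius `1 / (k + 1)` in `ℝⁿ`, as a smooth manifold. -/
def toMfd (n k : ℕ) : SmthMfd.{u} where
  carrier := Disk.{u} n k
  dim := n

/-- The inclusion of a smaller disk in a larger one. -/
def incl (n : ℕ) {k l : ℕ} (h : k ≤ l) : toMfd.{u} n l ⟶ toMfd.{u} n k :=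
  ⟨fun x => ⟨⟨x.down.1, Metric.ball_subset_ball
      (one_div_le_one_div_of_le (by positivity) (by simpa using h)) x.down.2⟩⟩,
    ContMDiff.of_comp_isOpenEmbedding (isOpenEmbedding_val n k)
      (contMDiff_isOpenEmbedding (isOpenEmbedding_val n l))⟩

/-- The sequence of disks around the origin of `ℝⁿ` of radius `1`, `1 / 2`, `1 / 3`, … -/
def diagram (n : ℕ) : ℕ ⥤ SmthMfd.{u}ᵒᵖ where
  obj k := op (toMfd.{u} n k)
  map f := (incl n (leOfHom f)).op
  map_id _ := rfl
  map_comp _ _ := rfl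

end Disk

/-- The `n`-stalk `F ↦ colimₖ F(Dⁿ_{1/(k+1)})` at the origin of the open `n`-disk. -/
def stalkFunctor (n : ℕ) : MfdPsh.{u} ⥤ Type u :=
  (Functor.whiskeringLeft _ _ _).obj (Disk.diagram.{u} n) ⋙ colim

/-- A simplicial manifold is locally fibrant if the simplicial sheaf that it represents is stalkwise
a Kan complex. -/
def IsLocallyFibrant (X : SimplicialMfd.{u}) : Prop :=
  ∀ n : ℕ, SSet.KanComplex.{u}
    (((SimplicialObject.whiskering _ _).obj (stalkFunctor.{u} n)).obj (SimplicialMfd.toPsh X))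

/-! ### Décalage -/

/-- The extension `f ⋆ [0] : [p + 1] → [q + 1]` of a monotone map `f : [p] → [q]` which sends the
last element to the last element. -/
def joinPointHom {p q : ℕ} (f : Fin (p + 1) →o Fin (q + 1)) : Fin (p + 2) →o Fin (q + 2) where
  toFun := Fin.lastCases (Fin.last (q + 1)) fun i => (f i).castSucc
  monotone' := by
    intro i j hij
    induction j using Fin.lastCases with
    | last => simpa using Fin.le_last _
    | cast j =>
      induction i using Fin.lastCases with
      | last => exact absurd hij (not_le.2 (Fin.castSucc_lt_last j))
      | cast i =>
        simp only [Fin.lastCases_castSucc]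
        exact Fin.castSucc_le_castSucc_iff.2 (f.monotone (Fin.castSucc_le_castSucc_iff.1 hij))

@[simp]
lemma joinPointHom_last {p q : ℕ} (f : Fin (p + 1) →o Fin (q + 1)) :
    joinPointHom f (Fin.last (p + 1)) = Fin.last (q + 1) :=
  Fin.lastCases_last (motive := fun _ => Fin (q + 2))

@[simp]
lemma joinPointHom_castSucc {p q : ℕ} (f : Fin (p + 1) →o Fin (q + 1)) (i : Fin (p + 1)) :
    joinPointHom f i.castSucc = (f i).castSucc :=
  Fin.lastCases_castSucc (motive := fun _ => Fin (q + 2)) i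

/-- The functor `[n] ↦ [n] ⋆ [0] = [n + 1]`. -/
def joinPoint : SimplexCategory ⥤ SimplexCategory where
  obj p := ⦋p.len + 1⦌
  map f := SimplexCategory.mkHom (joinPointHom f.toOrderHom)
  map_id p := by
    ext i : 3
    change joinPointHom _ i = i
    induction i using Fin.lastCases <;> simp
  map_comp f g := by
    ext i : 3
    change joinPointHom _ i = joinPointHom _ (joinPointHom _ i)
    induction i using Fin.lastCases <;> simp

/-- The inclusions `[n] ⟶ [n] ⋆ [0]`. -/
def inclJoinPoint : 𝟭 SimplexCategory ⟶ joinPoint where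
  app p := SimplexCategory.δ (Fin.last (p.len + 1))
  naturality p q f := by
    ext i : 3
    change Fin.succAbove (Fin.last (q.len + 1)) (f.toOrderHom i) =
      joinPointHom f.toOrderHom (Fin.succAbove (Fin.last (p.len + 1)) i)
    simp

section Decalage

variable {C : Type w} [Category.{v} C]

/-- The plain décalage `Dec₀ X`, with `(Dec₀ X)ₙ = Xₙ₊₁`. -/
def dec (X : SimplicialObject C) : SimplicialObject C :=
  joinPoint.op ⋙ X

/-- The canonical morphism `Dec₀ X ⟶ X`, given in degree `n` by `dₙ₊₁ : Xₙ₊₁ ⟶ Xₙ`. -/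
def decTo (X : SimplicialObject C) : dec X ⟶ X where
  app p := X.map (inclJoinPoint.app p.unop).op
  naturality p q f := by
    have h := inclJoinPoint.naturality f.unop
    dsimp [dec] at h ⊢
    rw [← X.map_comp, ← X.map_comp]
    congr 1
    exact Quiver.Hom.unop_inj h.symm

variable {n : ℕ} (k : Fin (n + 1))

/-- If `x` is a simplex of `Λ[n, k]`, then `x ⋆ [0]` is a simplex of `Λ[n + 1, k]`. -/
def hornJoin {p : SimplexCategoryᵒᵖ} (x : (SSet.horn.{0} n k : SSet.{0}).obj p) :
    (SSet.horn.{0} (n + 1) k.castSucc : SSet.{0}).obj (joinPoint.op.obj p) :=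
  ⟨SSet.stdSimplex.objEquiv.symm (joinPoint.map (SSet.stdSimplex.objEquiv x.1)), by
    obtain ⟨x, hx⟩ := x
    rw [SSet.mem_horn_iff, Set.ne_univ_iff_exists_notMem] at hx ⊢
    obtain ⟨j, hj⟩ := hx
    refine ⟨j.castSucc, ?_⟩
    simp only [Set.mem_union, Set.mem_range, Set.mem_singleton_iff, not_or, not_exists] at hj ⊢
    refine ⟨fun i => ?_, fun h => hj.2 (Fin.castSucc_injective _ h)⟩
    change joinPointHom (SSet.stdSimplex.objEquiv x).toOrderHom i ≠ _
    induction i using Fin.lastCases with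
    | last =>
      exact fun h => (Fin.castSucc_lt_last j).ne ((joinPointHom_last _).symm.trans h).symm
    | cast i =>
      exact fun h => hj.1 i
        (Fin.castSucc_injective _ ((joinPointHom_castSucc _ _).symm.trans h))⟩

/-- The face of `Δ[n + 1]` opposite to the last vertex, as a simplex of `Λ[n + 1, k]` for
`k ≤ n`. -/
def hornLastFace : (SSet.horn.{0} (n + 1) k.castSucc : SSet.{0}).obj (op ⦋n⦌) :=
  ⟨SSet.stdSimplex.objEquiv.symm (SimplexCategory.δ (Fin.last (n + 1))), by
    rw [SSet.mem_horn_iff, Set.ne_univ_iff_exists_notMem]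
    refine ⟨Fin.last (n + 1), ?_⟩
    simp only [Set.mem_union, Set.mem_range, Set.mem_singleton_iff, not_or, not_exists]
    refine ⟨fun i => ?_, (Fin.castSucc_lt_last k).ne'⟩
    change Fin.succAbove (Fin.last (n + 1)) i ≠ _
    exact Fin.succAbove_ne _ i⟩

/-- The cone whose component at a simplex `x` of `Λ[n, k]` is the projection at `x ⋆ [0]`. -/
def decCone {X : SimplicialObject C}
    (c : Cone (matchingDiagram (SSet.horn.{0} (n + 1) k.castSucc : SSet.{0}) X)) :
    Cone (matchingDiagram (SSet.horn.{0} n k : SSet.{0}) (dec X)) where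
  pt := c.pt
  π :=
    { app := fun x => c.π.app ⟨joinPoint.op.obj x.1, hornJoin k x.2⟩
      naturality := by
        intro x y f
        have h : (SSet.horn.{0} (n + 1) k.castSucc : SSet.{0}).map (joinPoint.op.map f.1)
            (hornJoin k x.2) = hornJoin k y.2 := by
          apply Subtype.ext
          apply SSet.stdSimplex.objEquiv.injective
          have h' : SSet.stdSimplex.objEquiv y.2.1 =
              f.1.unop ≫ SSet.stdSimplex.objEquiv x.2.1 :=
            congrArg (fun z => SSet.stdSimplex.objEquiv (Subtype.val z)) f.2.symm
          refine (joinPoint.map_comp f.1.unop (SSet.stdSimplex.objEquiv x.2.1)).symm.trans ?_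
          exact congrArg (fun g => joinPoint.map g) h'.symm
        exact c.π.naturality (CategoryOfElements.homMk
          ⟨joinPoint.op.obj x.1, hornJoin k x.2⟩ ⟨joinPoint.op.obj y.1, hornJoin k y.2⟩
          (joinPoint.op.map f.1) h) }

/-- The canonical morphism `M_{Λ[n + 1, k]} X ⟶ M_{Λ[n, k]} (Dec₀ X)`. -/
def MatchingObject.toDec {X : SimplicialObject C}
    (M : MatchingObject (SSet.horn.{0} (n + 1) k.castSucc : SSet.{0}) X)
    (D : MatchingObject (SSet.horn.{0} n k : SSet.{0}) (dec X)) : M.cone.pt ⟶ D.cone.pt :=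
  D.isLimit.lift (decCone k M.cone)

/-- The projection `M_{Λ[n + 1, k]} X ⟶ Xₙ` to the face opposite to the last vertex. -/
def MatchingObject.toLastFace {X : SimplicialObject C}
    (M : MatchingObject (SSet.horn.{0} (n + 1) k.castSucc : SSet.{0}) X) :
    M.cone.pt ⟶ X _⦋n⦌ :=
  M.cone.π.app ⟨op ⦋n⦌, hornLastFace k⟩

end Decalage

end

/-! The proof is Moore's argument that simplicial groups are Kan, carried out with smooth
parameters. Given the faces `x i`, `i ≠ k`, of a horn, start from the unit and correct one face at a
time, replacing `w` by `w * s ((d w)⁻¹ * x i)`, where `d` is the `i`-th face and `s` a degeneracy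
with `d ∘ s = id`. In a suitable order no correction disturbs the faces already filled in
(`act_δ_fillStep`). The filler is a word in group operations and structure maps, so it depends
smoothly on the faces.

Filling the horn of a simplex again gives a smooth idempotent `hornRetraction` of the group of
simplices, and two simplices have the same image exactly when they have the same horn. Its fixed
points are therefore a model for the space of horns. Near a fixed point a smooth idempotent becomes
linear in a suitable chart (`FixedSlice.exists_of_idempotent`). As faces are homomorphisms, the
level sets form a congruence, so the group acts transitively on the fixed points by translations,
which carry one slice chart everywhere. Translations also give a smooth section of the retraction
through every point, which makes it a submersion (`isSubmersion_of_sections`). The filler supplies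
the universal property (`hornMatchingObject`).

The remaining claims reuse the filler. Face maps have translated degeneracies as sections. The
décalage square is a pullback because a simplex and a horn of the décalage glue to a compatible
family, which can be filled. Opposite horns are compared through the sections given by filling. For
local fibrancy, finitely many germs and equations between them are realized on one disk, where the
filler applies. -/

noncomputable section

/-! ### Intersections of faces and faces of degeneracies. -/

namespace SimplexCategory

/-- Two faces `δ i`, `δ j` with `i < j` meet in a face of codimension two. -/
lemma exists_factor_of_comp_δ_eq {p : SimplexCategory} {n : ℕ} {i : Fin (n + 2)} {j : Fin (n + 3)}
    (hij : i.castSucc < j) (f g : p ⟶ ⦋n + 1⦌) (h : f ≫ δ i.castSucc = g ≫ δ j) :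
    ∃ e : p ⟶ ⦋n⦌, f = e ≫ δ (j.pred hij.ne_zero) ∧ g = e ≫ δ i := by
  have hval : ∀ a, i.castSucc.succAbove (f.toOrderHom a) = j.succAbove (g.toOrderHom a) :=
    fun a => congrArg (fun t => t.toOrderHom a) h
  have hg : ∀ a, g.toOrderHom a ≠ i := by
    intro a ha
    have h1 := hval a
    rw [ha, Fin.succAbove_of_castSucc_lt _ _ hij] at h1
    exact Fin.succAbove_ne _ _ h1
  refine ⟨factor_δ g i, ?_, (factor_δ_spec g i hg).symm⟩
  have hg' := factor_δ_spec g i hg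
  have : Mono (δ i.castSucc : ⦋n + 1⦌ ⟶ _) := inferInstance
  rw [← cancel_mono (δ i.castSucc), h, Category.assoc, ← δ_comp_δ' hij, ← Category.assoc, hg']

/-- A face of a degeneracy factors through a face `a` which `δ i` carries into the face `δ j`. -/
lemma exists_δ_comp_σ_eq {n : ℕ} {i j : Fin (n + 2)} {l : Fin (n + 1)}
    (h : (j < i ∧ j.val < l.val) ∨ (i < j ∧ l.val + 1 < j.val)) :
    ∃ (p : SimplexCategory) (a b : p ⟶ ⦋n⦌) (c : ⦋n⦌ ⟶ p),
      δ j ≫ σ l = c ≫ a ∧ a ≫ δ i = b ≫ δ j := by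
  obtain _ | n := n
  -- Here `l = 0` and `j ≤ 1`, so both alternatives are impossible.
  · omega
  rcases h with ⟨hji, hjl⟩ | ⟨hij, hlj⟩
  · obtain ⟨j, rfl⟩ := j.eq_castSucc_of_ne_last (Fin.ne_last_of_lt hji)
    obtain ⟨l, rfl⟩ := l.eq_succ_of_ne_zero (fun h => by simp [h] at hjl)
    refine ⟨_, δ j, δ (i.pred hji.ne_zero), σ l, δ_comp_σ_of_le ?_, δ_comp_δ' hji⟩
    simp only [Fin.val_castSucc, Fin.val_succ] at hjl
    exact Fin.le_def.2 (Nat.lt_succ_iff.1 hjl)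
  · obtain ⟨j, rfl⟩ := j.eq_succ_of_ne_zero (Fin.ne_zero_of_lt hij)
    obtain ⟨i, rfl⟩ := i.eq_castSucc_of_ne_last (Fin.ne_last_of_lt hij)
    simp only [Fin.val_succ] at hlj
    obtain ⟨l, rfl⟩ := l.eq_castSucc_of_ne_last
      (fun h => by have := j.2; simp [h] at hlj; omega)
    refine ⟨_, δ j, δ i, σ l, δ_comp_σ_of_gt ?_, (δ_comp_δ ?_).symm⟩
    · simp only [Fin.val_castSucc] at hlj
      exact Fin.lt_def.2 (by simpa using hlj)
    · exact Fin.castSucc_lt_succ_iff.1 hij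

end SimplexCategory

/-! ### Moore's horn filler and the induced smooth idempotent. -/

namespace SimplicialLieGroup

variable (G : SimplicialLieGroup.{u})

/-- The group homomorphism induced by a structure map of a simplicial Lie group. -/
def act {p q : SimplexCategory} (f : p ⟶ q) :
    (G.obj (op q)).carrier →* (G.obj (op p)).carrier :=
  (G.map f.op).toMonoidHom

lemma act_comp {p q r : SimplexCategory} (f : p ⟶ q) (g : q ⟶ r)
    (x : (G.obj (op r)).carrier) : G.act (f ≫ g) x = G.act f (G.act g x) :=
  congrArg (fun t : G.obj (op r) ⟶ G.obj (op p) => t.toFun x) (G.map_comp g.op f.op)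

lemma act_id {p : SimplexCategory} (x : (G.obj (op p)).carrier) : G.act (𝟙 p) x = x :=
  congrArg (fun t : G.obj (op p) ⟶ G.obj (op p) => t.toFun x) (G.map_id (op p))

lemma contMDiff_act {p q : SimplexCategory} (f : p ⟶ q) :
    ContMDiff (𝓡 (G.obj (op q)).dim) (𝓡 (G.obj (op p)).dim) ∞ (G.act f) :=
  (G.map f.op).contMDiff_toFun

variable {G} {n : ℕ}

/-- A family of `n`-simplices is compatible if it consists of the faces other than the `k`-th one
of a horn `Λ[n + 1, k]`. The entry with index `k` is irrelevant. -/
def HornCompatible (k : Fin (n + 2)) (x : Fin (n + 2) → (G.obj (op ⦋n⦌)).carrier) : Prop :=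
  ∀ ⦃i j : Fin (n + 2)⦄, i ≠ k → j ≠ k → ∀ ⦃p : SimplexCategory⦄ (f g : p ⟶ ⦋n⦌),
    f ≫ SimplexCategory.δ i = g ≫ SimplexCategory.δ j → G.act f (x i) = G.act g (x j)

/-- The order in which the faces of a horn are filled in: first the faces below `k` in ascending
order, then the faces above `k` in descending order. -/
def fillIndex (k : Fin (n + 2)) (t : ℕ) : Fin (n + 2) :=
  ⟨if t < k then t else n + 1 - (t - k), by split <;> omega⟩

/-- The index of a degeneracy which is a section of the `i`-th face, for `i ≠ k`. -/
def fillDegeneracy (k i : Fin (n + 2)) : Fin (n + 1) :=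
  ⟨if i < k then i else i - 1, by split <;> omega⟩

/-- The element obtained from the unit after `t` steps of Moore's algorithm for filling horns in
simplicial groups. -/
def fillStep (k : Fin (n + 2)) (x : Fin (n + 2) → (G.obj (op ⦋n⦌)).carrier) (r : ℕ) :
    (G.obj (op ⦋n + 1⦌)).carrier :=
  match r with
  | 0 => 1
  | t + 1 => fillStep k x t * G.act (SimplexCategory.σ (fillDegeneracy k (fillIndex k t)))
      ((G.act (SimplexCategory.δ (fillIndex k t)) (fillStep k x t))⁻¹ * x (fillIndex k t))

/-- Moore's filler of a horn in a simplicial group. -/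
def fill (k : Fin (n + 2)) (x : Fin (n + 2) → (G.obj (op ⦋n⦌)).carrier) :
    (G.obj (op ⦋n + 1⦌)).carrier :=
  fillStep k x (n + 1)

lemma fillIndex_ne (k : Fin (n + 2)) {t : ℕ} (ht : t < n + 1) : fillIndex k t ≠ k := by
  intro h
  have := congrArg Fin.val h
  simp only [fillIndex] at this
  split at this <;> omega

lemma exists_fillIndex_eq {k i : Fin (n + 2)} (h : i ≠ k) :
    ∃ t < n + 1, fillIndex k t = i := by
  rcases lt_or_gt_of_ne h with h | h
  · exact ⟨i, by omega, Fin.ext (by simp [fillIndex, h])⟩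
  · refine ⟨n + 1 - i + k, by omega, Fin.ext ?_⟩
    simp only [fillIndex]
    split <;> omega

lemma δ_comp_σ_fillDegeneracy {k i : Fin (n + 2)} (h : i ≠ k) :
    SimplexCategory.δ i ≫ SimplexCategory.σ (fillDegeneracy k i) = 𝟙 _ := by
  rcases lt_or_gt_of_ne h with h | h
  · exact SimplexCategory.δ_comp_σ_self' (Fin.ext (by simp [fillDegeneracy, h]))
  · exact SimplexCategory.δ_comp_σ_succ' (Fin.ext (by
      simp only [fillDegeneracy, Fin.val_succ]; split <;> omega))

/-- This is what dictates the filling order: a face treated earlier must commute past the degeneracy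
used now. Below `k` the degeneracy has the index of the face, so earlier faces must be smaller;
above `k` it has index one less, so earlier faces must be larger or lie below `k`. -/
lemma fillIndex_rel (k : Fin (n + 2)) {r t : ℕ} (hrt : r < t) (ht : t < n + 1) :
    (fillIndex k r < fillIndex k t ∧
        (fillIndex k r).val < (fillDegeneracy k (fillIndex k t)).val) ∨
      (fillIndex k t < fillIndex k r ∧
        (fillDegeneracy k (fillIndex k t)).val + 1 < (fillIndex k r).val) := by
  simp only [fillIndex, fillDegeneracy, Fin.lt_def]
  split_ifs <;> omega

lemma act_δ_fillStep {k : Fin (n + 2)} {x : Fin (n + 2) → (G.obj (op ⦋n⦌)).carrier}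
    (hx : HornCompatible k x) {t : ℕ} (ht : t ≤ n + 1) {r : ℕ} (hr : r < t) :
    G.act (SimplexCategory.δ (fillIndex k r)) (fillStep k x t) = x (fillIndex k r) := by
  induction t generalizing r with
  | zero => omega
  | succ t ih =>
    have hne := fillIndex_ne k (Nat.lt_of_succ_le ht)
    rw [fillStep, map_mul, ← act_comp]
    rcases Nat.lt_succ_iff_lt_or_eq.1 hr with hr | rfl
    · obtain ⟨p, a, b, c, h1, h2⟩ :=
        SimplexCategory.exists_δ_comp_σ_eq (fillIndex_rel k hr (Nat.lt_of_succ_le ht))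
      have ihr := ih (by omega) hr
      -- On the earlier face `j` the correction factors through `a`, where it equals the inverse of
      -- `b^* (x j)` times `a^* (x i)`: the face `j` is already right by induction. Compatibility
      -- makes this product trivial.
      rw [h1, act_comp, map_mul (G.act a), map_inv (G.act a), ← act_comp, h2, act_comp, ihr,
        ← hx hne (fillIndex_ne k (by omega)) a b h2, inv_mul_cancel, map_one, mul_one]
    · rw [δ_comp_σ_fillDegeneracy hne, act_id, mul_inv_cancel_left]

/-- Moore's filler has the prescribed faces. -/
lemma act_δ_fill {k : Fin (n + 2)} {x : Fin (n + 2) → (G.obj (op ⦋n⦌)).carrier}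
    (hx : HornCompatible k x) {i : Fin (n + 2)} (hi : i ≠ k) :
    G.act (SimplexCategory.δ i) (fill k x) = x i := by
  obtain ⟨t, ht, rfl⟩ := exists_fillIndex_eq hi
  exact act_δ_fillStep hx le_rfl ht

/-- The algorithm never visits the index `k`, so the value there cannot matter. -/
lemma fillStep_congr {k : Fin (n + 2)} {x y : Fin (n + 2) → (G.obj (op ⦋n⦌)).carrier}
    (h : ∀ i, i ≠ k → x i = y i) {t : ℕ} (ht : t ≤ n + 1) : fillStep k x t = fillStep k y t := by
  induction t with
  | zero => rfl
  | succ t ih =>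
    rw [fillStep, fillStep, ih (by omega), h _ (fillIndex_ne k (by omega))]

lemma fill_congr {k : Fin (n + 2)} {x y : Fin (n + 2) → (G.obj (op ⦋n⦌)).carrier}
    (h : ∀ i, i ≠ k → x i = y i) : fill k x = fill k y :=
  fillStep_congr h le_rfl

lemma contMDiff_fillStep {T : SmthMfd.{u}} (k : Fin (n + 2))
    {x : T.carrier → Fin (n + 2) → (G.obj (op ⦋n⦌)).carrier}
    (hx : ∀ i, ContMDiff (𝓡 T.dim) (𝓡 (G.obj (op ⦋n⦌)).dim) ∞ fun t => x t i) (r : ℕ) :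
    ContMDiff (𝓡 T.dim) (𝓡 (G.obj (op ⦋n + 1⦌)).dim) ∞ fun t => fillStep k (x t) r := by
  induction r with
  | zero => exact contMDiff_const
  | succ r ih =>
    exact ih.mul ((contMDiff_act G _).comp ((((contMDiff_act G _).comp ih).inv).mul (hx _)))

lemma contMDiff_fill {T : SmthMfd.{u}} (k : Fin (n + 2))
    {x : T.carrier → Fin (n + 2) → (G.obj (op ⦋n⦌)).carrier}
    (hx : ∀ i, ContMDiff (𝓡 T.dim) (𝓡 (G.obj (op ⦋n⦌)).dim) ∞ fun t => x t i) :
    ContMDiff (𝓡 T.dim) (𝓡 (G.obj (op ⦋n + 1⦌)).dim) ∞ fun t => fill k (x t) :=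
  contMDiff_fillStep k hx _

/-- The faces of a simplex form a compatible family. -/
lemma hornCompatible_faces (k : Fin (n + 2)) (z : (G.obj (op ⦋n + 1⦌)).carrier) :
    HornCompatible k fun i => G.act (SimplexCategory.δ i) z := by
  intro i j _ _ p f g h
  rw [← act_comp, ← act_comp, h]

/-- The smooth idempotent that sends a simplex to the canonical filler of its `k`-th horn. -/
def hornRetraction (G : SimplicialLieGroup.{u}) (k : Fin (n + 2))
    (z : (G.obj (op ⦋n + 1⦌)).carrier) : (G.obj (op ⦋n + 1⦌)).carrier :=
  fill k fun i => G.act (SimplexCategory.δ i) z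

lemma act_δ_hornRetraction {k i : Fin (n + 2)} (hi : i ≠ k)
    (z : (G.obj (op ⦋n + 1⦌)).carrier) :
    G.act (SimplexCategory.δ i) (G.hornRetraction k z) = G.act (SimplexCategory.δ i) z :=
  act_δ_fill (hornCompatible_faces k z) hi

lemma hornRetraction_congr {k : Fin (n + 2)} {y z : (G.obj (op ⦋n + 1⦌)).carrier}
    (h : ∀ i, i ≠ k → G.act (SimplexCategory.δ i) y = G.act (SimplexCategory.δ i) z) :
    G.hornRetraction k y = G.hornRetraction k z :=
  fill_congr h

lemma contMDiff_hornRetraction (k : Fin (n + 2)) :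
    ContMDiff (𝓡 (G.obj (op ⦋n + 1⦌)).dim) (𝓡 (G.obj (op ⦋n + 1⦌)).dim) ∞
      (G.hornRetraction k) :=
  contMDiff_fill (T := (G.obj (op ⦋n + 1⦌)).toSmthMfd) k fun _ => contMDiff_act G _

end SimplicialLieGroup

/-! ### Charts from the inverse function theorem. -/

section InverseFunction

variable {E : Type*} [NormedAddCommGroup E] [NormedSpace ℝ E] [CompleteSpace E]

/-- The inverse function theorem, with smoothness of the inverse on a neighbourhood. -/
lemma ContDiffOn.exists_openPartialHomeomorph {h : E → E} {s : Set E} (hs : IsOpen s) {a : E}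
    (ha : a ∈ s) (hh : ContDiffOn ℝ ∞ h s) {L : E ≃L[ℝ] E} (hL : HasFDerivAt h (L : E →L[ℝ] E) a) :
    ∃ Φ : OpenPartialHomeomorph E E, a ∈ Φ.source ∧ Φ.source ⊆ s ∧ (Φ : E → E) = h ∧
      ContDiffOn ℝ ∞ Φ.symm Φ.target := by
  have hne : (∞ : WithTop ℕ∞) ≠ 0 := by simp
  have hat : ∀ y ∈ s, ContDiffAt ℝ ∞ h y := fun y hy => hh.contDiffAt (hs.mem_nhds hy)
  -- Invertibility of the derivative is an open condition. Restricting to it makes the inverse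
  -- smooth on the whole target, not only at the image of `a`.
  set t : Set E := s ∩ fderiv ℝ h ⁻¹' Set.range ((↑) : (E ≃L[ℝ] E) → E →L[ℝ] E) with ht
  have hto : IsOpen t := (hh.continuousOn_fderiv_of_isOpen hs (by simp)).isOpen_inter_preimage hs
    ContinuousLinearEquiv.isOpen
  set Ψ := (hat a ha).toOpenPartialHomeomorph h hL hne
  refine ⟨Ψ.restrOpen t hto, ?_, ?_, rfl, ?_⟩
  · exact ⟨(hat a ha).mem_toOpenPartialHomeomorph_source hL hne, ha, L, hL.fderiv.symm⟩
  · exact fun y hy => hy.2.1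
  · intro y hy
    have hy' : (Ψ.restrOpen t hto).symm y ∈ t := ((Ψ.restrOpen t hto).map_target hy).2
    obtain ⟨hys, K, hK⟩ := hy'
    refine ((Ψ.restrOpen t hto).contDiffAt_symm hy (f₀' := K) ?_ (hat _ hys)).contDiffWithinAt
    rw [hK]
    exact ((hat _ hys).differentiableAt hne).hasFDerivAt

/-- A smooth map from a manifold to its model space which is invertible to first order at `x`
is a chart around `x`. -/
lemma ContMDiffOn.exists_chart {M : Type*} [TopologicalSpace M] [ChartedSpace E M]
    [IsManifold 𝓘(ℝ, E) ∞ M] {h : M → E} {U : Set M} (hU : IsOpen U) {x : M} (hx : x ∈ U)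
    (hh : ContMDiffOn 𝓘(ℝ, E) 𝓘(ℝ, E) ∞ h U) {L : E ≃L[ℝ] E}
    (hL : HasFDerivAt (h ∘ (chartAt E x).symm) (L : E →L[ℝ] E) (chartAt E x x)) :
    ∃ Φ ∈ IsManifold.maximalAtlas 𝓘(ℝ, E) ∞ M, x ∈ Φ.source ∧ Φ.source ⊆ U ∧
      ∀ y ∈ Φ.source, Φ y = h y := by
  set φ := chartAt E x
  have hφs : ContMDiffOn 𝓘(ℝ, E) 𝓘(ℝ, E) ∞ φ.symm φ.target := contMDiffOn_chart_symm
  have hφ : ContMDiffOn 𝓘(ℝ, E) 𝓘(ℝ, E) ∞ φ φ.source := contMDiffOn_chart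
  have hs : IsOpen (φ.target ∩ φ.symm ⁻¹' U) := φ.isOpen_inter_preimage_symm hU
  have hxs : x ∈ φ.source := mem_chart_source E x
  have hsm : ContDiffOn ℝ ∞ (h ∘ φ.symm) (φ.target ∩ φ.symm ⁻¹' U) :=
    contMDiffOn_iff_contDiffOn.1 (hh.comp (hφs.mono Set.inter_subset_left) fun y hy => hy.2)
  obtain ⟨Φ, haΦ, hΦs, hΦ, hΦsymm⟩ := hsm.exists_openPartialHomeomorph hs
    ⟨φ.map_source hxs, by simpa [φ.left_inv hxs] using hx⟩ hL
  have hcoe : ∀ y ∈ (φ ≫ₕ Φ).source, (φ ≫ₕ Φ) y = h y := by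
    intro y hy
    simp only [OpenPartialHomeomorph.trans_source, Set.mem_inter_iff, Set.mem_preimage] at hy
    simp [hΦ, φ.left_inv hy.1]
  have hsub : (φ ≫ₕ Φ).source ⊆ U := by
    intro y hy
    simp only [OpenPartialHomeomorph.trans_source, Set.mem_inter_iff, Set.mem_preimage] at hy
    simpa [φ.left_inv hy.1] using (hΦs hy.2).2
  refine ⟨φ ≫ₕ Φ, OpenPartialHomeomorph.mem_maximalAtlas_of_contMDiffOn _
    ((hh.mono hsub).congr hcoe) ?_, ?_, hsub, hcoe⟩
  · refine hφs.comp ((contMDiffOn_iff_contDiffOn.2 hΦsymm).mono ?_) ?_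
    · exact fun y hy => hy.1
    · exact fun y hy => hy.2
  · exact ⟨hxs, haΦ⟩

end InverseFunction

/-! ### Submersions from smooth sections. -/

namespace SmthMfd

/-- A surjective linear map of Euclidean spaces is a projection up to a change of coordinates. -/
lemma exists_equiv_fst_eq {m n : ℕ}
    {A : EuclideanSpace ℝ (Fin m) →L[ℝ] EuclideanSpace ℝ (Fin n)}
    {B : EuclideanSpace ℝ (Fin n) →L[ℝ] EuclideanSpace ℝ (Fin m)}
    (h : A.comp B = ContinuousLinearMap.id ℝ _) :
    ∃ L : EuclideanSpace ℝ (Fin m) ≃L[ℝ]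
      (EuclideanSpace ℝ (Fin n) × EuclideanSpace ℝ (Fin (m - n))), ∀ v, (L v).1 = A v := by
  have hr : Function.RightInverse B A := fun v => congrArg (fun t => t v) h
  -- The right inverse makes `A` surjective, so rank-nullity gives `n ≤ m` and the truncated
  -- subtraction is exact.
  have hdim : Module.finrank ℝ A.ker =
      Module.finrank ℝ (EuclideanSpace ℝ (Fin (m - n))) := by
    have := LinearMap.finrank_range_add_finrank_ker A.toLinearMap
    rw [LinearMap.range_eq_top.2 hr.surjective] at this
    simp at this ⊢
    omega
  refine ⟨(ContinuousLinearEquiv.equivOfRightInverse A B hr).trans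
    ((ContinuousLinearEquiv.refl ℝ _).prodCongr (ContinuousLinearEquiv.ofFinrankEq hdim)), ?_⟩
  intro v
  simp

/-- A smooth map which has a smooth section through every point of its source is a submersion. -/
lemma isSubmersion_of_sections {M N : SmthMfd.{u}} (f : M ⟶ N)
    (hs : ∀ x : M.carrier, ∃ s : N ⟶ M, toFun s (toFun f x) = x ∧
      ∀ y, toFun f (toFun s y) = y) : IsSubmersion f := by
  refine Manifold.IsSubmersionOfComplement.isSubmersion
    (F := EuclideanSpace ℝ (Fin (M.dim - N.dim))) fun x => ?_
  obtain ⟨s, hsx, hsf⟩ := hs x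
  have hf : ContMDiff (𝓡 M.dim) (𝓡 N.dim) ∞ (toFun f) := f.2
  have hsm : ContMDiff (𝓡 N.dim) (𝓡 M.dim) ∞ (toFun s) := s.2
  set φ := chartAt (EuclideanSpace ℝ (Fin M.dim)) x with hφdef
  set ψ := chartAt (EuclideanSpace ℝ (Fin N.dim)) (toFun f x) with hψdef
  have hxφ : x ∈ φ.source := mem_chart_source _ x
  have hxψ : toFun f x ∈ ψ.source := mem_chart_source _ _
  set a := φ x with ha
  set b := ψ (toFun f x) with hb
  have hbt : b ∈ ψ.target := ψ.map_source hxψ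
  have hat : a ∈ φ.target := φ.map_source hxφ
  have hψb : ψ.symm b = toFun f x := ψ.left_inv hxψ
  have hφa : φ.symm a = x := φ.left_inv hxφ
  set F := ψ ∘ toFun f ∘ φ.symm with hF
  set S := φ ∘ toFun s ∘ ψ.symm with hS
  have hSb : S b = a := by simp [hS, hψb, hsx, ha]
  have hψa : ContMDiffAt (𝓡 N.dim) (𝓡 N.dim) ∞ ψ (toFun f x) :=
    contMDiffOn_chart.contMDiffAt (ψ.open_source.mem_nhds hxψ)
  have hφat : ContMDiffAt (𝓡 M.dim) (𝓡 M.dim) ∞ φ x :=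
    contMDiffOn_chart.contMDiffAt (φ.open_source.mem_nhds hxφ)
  have hψs : ContMDiffAt (𝓡 N.dim) (𝓡 N.dim) ∞ ψ.symm b :=
    contMDiffOn_chart_symm.contMDiffAt (ψ.open_target.mem_nhds hbt)
  have hφs : ContMDiffAt (𝓡 M.dim) (𝓡 M.dim) ∞ φ.symm a :=
    contMDiffOn_chart_symm.contMDiffAt (φ.open_target.mem_nhds hat)
  have hFd : DifferentiableAt ℝ F a := by
    have h : ContMDiffAt (𝓡 M.dim) (𝓡 N.dim) ∞ F a := by
      refine ContMDiffAt.comp a (I' := 𝓡 N.dim) ?_ (hf.contMDiffAt.comp a hφs)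
      simpa [hφa] using hψa
    exact h.contDiffAt.differentiableAt (by simp)
  have hSd : DifferentiableAt ℝ S b := by
    have h : ContMDiffAt (𝓡 N.dim) (𝓡 M.dim) ∞ S b := by
      refine ContMDiffAt.comp b (I' := 𝓡 M.dim) ?_ (hsm.contMDiffAt.comp b hψs)
      simpa [hψb, hsx] using hφat
    exact h.contDiffAt.differentiableAt (by simp)
  have hFS : F ∘ S =ᶠ[nhds b] id := by
    have h1 : ∀ᶠ y in nhds b, y ∈ ψ.target := ψ.open_target.mem_nhds hbt
    have h2 : ∀ᶠ y in nhds b, toFun s (ψ.symm y) ∈ φ.source := by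
      refine (hsm.continuous.continuousAt.comp hψs.continuousAt).eventually_mem ?_
      simpa [hψb, hsx] using φ.open_source.mem_nhds hxφ
    filter_upwards [h1, h2] with y hy1 hy2
    simp [hF, hS, φ.left_inv hy2, hsf, ψ.right_inv hy1]
  -- Differentiating the identity `F ∘ S = id` near `b` shows that the derivative of `F` is split
  -- surjective.
  have hAB : (fderiv ℝ F a).comp (fderiv ℝ S b) = ContinuousLinearMap.id ℝ _ := by
    have h1 : HasFDerivAt (F ∘ S) ((fderiv ℝ F a).comp (fderiv ℝ S b)) b :=
      HasFDerivAt.comp b (by rw [hSb]; exact hFd.hasFDerivAt) hSd.hasFDerivAt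
    exact h1.unique ((hasFDerivAt_id b).congr_of_eventuallyEq hFS)
  obtain ⟨L, hL⟩ := exists_equiv_fst_eq hAB
  have hU : IsOpen (φ.source ∩ toFun f ⁻¹' ψ.source) :=
    φ.open_source.inter (ψ.open_source.preimage hf.continuous)
  -- The new coordinates keep the kernel component of `φ` and replace the complementary one by `ψ ∘
  -- f`. Their derivative in the chart `φ` at `a` is the identity, so they form a chart, in which
  -- `f` is the first projection after `L`.
  let h : M.carrier → EuclideanSpace ℝ (Fin M.dim) :=
    fun y => L.symm (ψ (toFun f y), (L (φ y)).2)
  have hh : ContMDiffOn (𝓡 M.dim) (𝓡 M.dim) ∞ h (φ.source ∩ toFun f ⁻¹' ψ.source) := by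
    have h1 : ContMDiffOn (𝓡 M.dim) (𝓡 N.dim) ∞ (fun y => ψ (toFun f y))
        (φ.source ∩ toFun f ⁻¹' ψ.source) :=
      (contMDiffOn_chart (I := 𝓡 N.dim)).comp hf.contMDiffOn fun y hy => hy.2
    have h2 : ContMDiffOn (𝓡 M.dim) 𝓘(ℝ, EuclideanSpace ℝ (Fin (M.dim - N.dim))) ∞
        (fun y => (L (φ y)).2) (φ.source ∩ toFun f ⁻¹' ψ.source) := by
      have h3 : ContDiff ℝ ∞ fun v => (L v).2 := by fun_prop
      exact h3.contMDiff.comp_contMDiffOn (contMDiffOn_chart.mono Set.inter_subset_left)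
    exact L.symm.contDiff.contMDiff.comp_contMDiffOn (h1.prodMk_space h2)
  have hd : HasFDerivAt (h ∘ φ.symm)
      (ContinuousLinearEquiv.refl ℝ (EuclideanSpace ℝ (Fin M.dim))).toContinuousLinearMap a := by
    let L₂ := (ContinuousLinearMap.snd ℝ (EuclideanSpace ℝ (Fin N.dim))
      (EuclideanSpace ℝ (Fin (M.dim - N.dim)))).comp L.toContinuousLinearMap
    have h1 : HasFDerivAt (fun v => L.symm (F v, (L v).2))
        (L.symm.toContinuousLinearMap.comp ((fderiv ℝ F a).prod L₂)) a :=
      L.symm.hasFDerivAt.comp a (hFd.hasFDerivAt.prodMk L₂.hasFDerivAt)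
    have h2 : L.symm.toContinuousLinearMap.comp ((fderiv ℝ F a).prod L₂) =
        (ContinuousLinearEquiv.refl ℝ (EuclideanSpace ℝ (Fin M.dim))).toContinuousLinearMap := by
      ext1 v
      apply L.injective
      simp [L₂, ← hL v]
    rw [h2] at h1
    refine h1.congr_of_eventuallyEq ?_
    filter_upwards [φ.open_target.mem_nhds hat] with v hv
    simp [h, hF, φ.right_inv hv]
  obtain ⟨Φ, hΦ, hxΦ, hΦU, hΦh⟩ := hh.exists_chart hU ⟨hxφ, hxψ⟩ hd
  refine Manifold.IsSubmersionAtOfComplement.mk_of_charts L Φ ψ hxΦ hxψ hΦ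
    (IsManifold.chart_mem_maximalAtlas _) (fun y hy => (hΦU hy).2) ?_
  intro v hv
  have hv' : v ∈ Φ.target := by simpa using hv
  have h1 := Φ.map_target hv'
  have h2 := congrArg (fun t => (L t).1) (Φ.right_inv hv')
  simp only [hΦh _ h1, h, ContinuousLinearEquiv.apply_symm_apply] at h2
  simpa using h2

end SmthMfd

/-! ### Fixed points of smooth idempotents. -/

/-- A smooth idempotent linear map of a Euclidean space splits through a Euclidean space. -/
lemma exists_splitting_of_idempotent {m : ℕ}
    {P : EuclideanSpace ℝ (Fin m) →L[ℝ] EuclideanSpace ℝ (Fin m)} (hP : ∀ v, P (P v) = P v) :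
    ∃ (d : ℕ) (ι : EuclideanSpace ℝ (Fin d) →L[ℝ] EuclideanSpace ℝ (Fin m))
      (π : EuclideanSpace ℝ (Fin m) →L[ℝ] EuclideanSpace ℝ (Fin d)),
      (∀ w, π (ι w) = w) ∧ ∀ v, ι (π v) = P v := by
  let V := P.toLinearMap.range
  let L : V ≃L[ℝ] EuclideanSpace ℝ (Fin (Module.finrank ℝ V)) :=
    ContinuousLinearEquiv.ofFinrankEq (by simp)
  refine ⟨_, V.subtypeL.comp L.symm.toContinuousLinearMap,
    L.toContinuousLinearMap.comp (P.codRestrict V fun v => ⟨v, rfl⟩), fun w => ?_, fun v => ?_⟩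
  · have h : P.codRestrict V (fun v => ⟨v, rfl⟩) (L.symm w : EuclideanSpace ℝ (Fin m)) =
        L.symm w := by
      obtain ⟨v, hv⟩ := (L.symm w).2
      apply Subtype.ext
      change P (L.symm w : EuclideanSpace ℝ (Fin m)) = _
      rw [← hv]
      exact hP v
    simp [h]
  · change ((L.symm (L (P.codRestrict V _ v)) : V) : EuclideanSpace ℝ (Fin m)) = P v
    rw [L.symm_apply_apply]
    rfl

/-- A chart around `x` in which the fixed points of `e` form a linear subspace. -/
structure FixedSlice (m : ℕ) {M : Type u} [TopologicalSpace M]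
    [ChartedSpace (EuclideanSpace ℝ (Fin m)) M] (e : M → M) (x : M) where
  dim : ℕ
  incl : EuclideanSpace ℝ (Fin dim) →L[ℝ] EuclideanSpace ℝ (Fin m)
  proj : EuclideanSpace ℝ (Fin m) →L[ℝ] EuclideanSpace ℝ (Fin dim)
  proj_incl : ∀ w, proj (incl w) = w
  chart : OpenPartialHomeomorph M (EuclideanSpace ℝ (Fin m))
  chart_mem : chart ∈ IsManifold.maximalAtlas (𝓡 m) ∞ M
  mem_source : x ∈ chart.source
  fixed_iff : ∀ y ∈ chart.source, e y = y ↔ incl (proj (chart y)) = chart y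

/-- Around a fixed point, the fixed points of a smooth idempotent are a slice of a chart. -/
lemma FixedSlice.exists_of_idempotent {m : ℕ} {M : Type u} [TopologicalSpace M]
    [ChartedSpace (EuclideanSpace ℝ (Fin m)) M] [IsManifold (𝓡 m) ∞ M] {e : M → M}
    (he : ContMDiff (𝓡 m) (𝓡 m) ∞ e) (hee : ∀ y, e (e y) = e y) {x : M} (hx : e x = x) :
    Nonempty (FixedSlice m e x) := by
  set φ := chartAt (EuclideanSpace ℝ (Fin m)) x with hφdef
  have hxφ : x ∈ φ.source := mem_chart_source _ x
  set a := φ x with ha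
  have hat : a ∈ φ.target := φ.map_source hxφ
  have hφa : φ.symm a = x := φ.left_inv hxφ
  set F := φ ∘ e ∘ φ.symm with hF
  have hFa : F a = a := by rw [hF, Function.comp_apply, Function.comp_apply, hφa, hx]
  have hφat : ContMDiffAt (𝓡 m) (𝓡 m) ∞ φ x :=
    contMDiffOn_chart.contMDiffAt (φ.open_source.mem_nhds hxφ)
  have hφs : ContMDiffAt (𝓡 m) (𝓡 m) ∞ φ.symm a :=
    contMDiffOn_chart_symm.contMDiffAt (φ.open_target.mem_nhds hat)
  have hFd : DifferentiableAt ℝ F a := by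
    have h : ContMDiffAt (𝓡 m) (𝓡 m) ∞ F a := by
      refine ContMDiffAt.comp a (I' := 𝓡 m) ?_ (he.contMDiffAt.comp a hφs)
      simpa [hφa, hx] using hφat
    exact h.contDiffAt.differentiableAt (by simp)
  have hFF : F ∘ F =ᶠ[nhds a] F := by
    have h2 : ∀ᶠ y in nhds a, e (φ.symm y) ∈ φ.source := by
      refine (he.continuous.continuousAt.comp hφs.continuousAt).eventually_mem ?_
      simpa [hφa, hx] using φ.open_source.mem_nhds hxφ
    filter_upwards [h2] with y hy
    simp [hF, φ.left_inv hy, hee]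
  set P := fderiv ℝ F a with hPdef
  have hPP : P.comp P = P := by
    have h1 : HasFDerivAt (F ∘ F) (P.comp P) a :=
      HasFDerivAt.comp a (by rw [hFa]; exact hFd.hasFDerivAt) hFd.hasFDerivAt
    exact h1.unique (hFd.hasFDerivAt.congr_of_eventuallyEq hFF)
  have hP : ∀ v, P (P v) = P v := fun v => congrArg (fun t => t v) hPP
  obtain ⟨d, ι, π, hπι, hιπ⟩ := exists_splitting_of_idempotent hP
  have hU : IsOpen (φ.source ∩ e ⁻¹' φ.source) :=
    φ.open_source.inter (φ.open_source.preimage he.continuous)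
  -- With `Q = 1 - P`, this is `P (φ (e y)) + Q (φ y - φ (e y))`. It intertwines `e` with the linear
  -- map `P`, and its derivative in the chart is `P * P + Q * Q = 1`.
  let h : M → EuclideanSpace ℝ (Fin m) := fun y => P (φ (e y)) + (φ y - φ (e y) - P (φ y - φ (e y)))
  have hhe : ∀ y, h (e y) = P (h y) := by
    intro y
    simp [h, hee, hP]
  have hh : ContMDiffOn (𝓡 m) (𝓡 m) ∞ h (φ.source ∩ e ⁻¹' φ.source) := by
    have h1 : ContMDiffOn (𝓡 m) (𝓡 m) ∞ (fun y => φ (e y)) (φ.source ∩ e ⁻¹' φ.source) :=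
      (contMDiffOn_chart (I := 𝓡 m)).comp he.contMDiffOn fun y hy => hy.2
    have h2 : ContMDiffOn (𝓡 m) (𝓡 m) ∞ φ (φ.source ∩ e ⁻¹' φ.source) :=
      contMDiffOn_chart.mono Set.inter_subset_left
    have h3 : ContDiff ℝ ∞
        fun v : EuclideanSpace ℝ (Fin m) × EuclideanSpace ℝ (Fin m) =>
          P v.1 + (v.2 - v.1 - P (v.2 - v.1)) := by fun_prop
    exact h3.contMDiff.comp_contMDiffOn (h1.prodMk_space h2)
  have hd : HasFDerivAt (h ∘ φ.symm)
      (ContinuousLinearEquiv.refl ℝ (EuclideanSpace ℝ (Fin m))).toContinuousLinearMap a := by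
    have h1 : HasFDerivAt (fun v => P (F v) + (v - F v - P (v - F v)))
        (P.comp P + (ContinuousLinearMap.id ℝ _ - P - P.comp (ContinuousLinearMap.id ℝ _ - P))) a :=
      have h0 := (hasFDerivAt_id a).sub hFd.hasFDerivAt
      (P.hasFDerivAt.comp a hFd.hasFDerivAt).add (h0.sub (P.hasFDerivAt.comp a h0))
    have h2 : P.comp P + (ContinuousLinearMap.id ℝ _ - P -
          P.comp (ContinuousLinearMap.id ℝ _ - P)) =
        (ContinuousLinearEquiv.refl ℝ (EuclideanSpace ℝ (Fin m))).toContinuousLinearMap := by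
      ext1 v
      simp [hP]
    rw [h2] at h1
    refine h1.congr_of_eventuallyEq ?_
    filter_upwards [φ.open_target.mem_nhds hat] with v hv
    simp [h, hF, φ.right_inv hv]
  obtain ⟨Φ, hΦ, hxΦ, -, hΦh⟩ := hh.exists_chart hU ⟨hxφ, by simpa [hx] using hxφ⟩ hd
  -- Both `y` and `e y` must lie in the chart, so that injectivity turns `Φ (e y) = Φ y` into `e y =
  -- y`.
  have ho : IsOpen (e ⁻¹' Φ.source) := Φ.open_source.preimage he.continuous
  refine ⟨⟨d, ι, π, hπι, Φ.restr (e ⁻¹' Φ.source), restr_mem_maximalAtlas _ hΦ ho, ?_, ?_⟩⟩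
  · rw [Φ.restr_source' _ ho]
    exact ⟨hxΦ, by simpa [hx] using hxΦ⟩
  · intro y hy
    rw [Φ.restr_source' _ ho] at hy
    have h1 : Φ (e y) = ι (π (Φ y)) := by
      rw [hιπ, hΦh _ hy.2, hΦh _ hy.1, hhe]
    simp only [OpenPartialHomeomorph.restr_apply]
    rw [← h1]
    exact ⟨fun h => by rw [h], fun h => Φ.injOn hy.2 hy.1 h⟩

/-! ### The quotient manifold of a smooth congruence. -/

/-- A smooth idempotent of a Lie group whose level sets are the classes of a congruence. -/
structure SmoothCongruence (G : LieGrp.{u}) where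
  toFun : G.carrier → G.carrier
  contMDiff : ContMDiff (𝓡 G.dim) (𝓡 G.dim) ∞ toFun
  idem : ∀ y, toFun (toFun y) = toFun y
  mul : ∀ ⦃a a' b b'⦄, toFun a = toFun a' → toFun b = toFun b' → toFun (a * b) = toFun (a' * b')

namespace SmoothCongruence

variable {G : LieGrp.{u}} (e : SmoothCongruence G)

/-- The subspace of fixed points, which represents the quotient by the congruence. -/
def Fixed : Type u := {y : G.carrier // e.toFun y = y}

instance : TopologicalSpace e.Fixed := inferInstanceAs (TopologicalSpace {y // e.toFun y = y})

instance : T2Space e.Fixed := inferInstanceAs (T2Space {y // e.toFun y = y})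

instance : ParacompactSpace e.Fixed :=
  (isClosed_eq e.contMDiff.continuous continuous_id).isClosedEmbedding_subtypeVal.paracompactSpace

/-- The projection onto the fixed points. -/
def retract (y : G.carrier) : e.Fixed := ⟨e.toFun y, e.idem y⟩

lemma continuous_retract : Continuous e.retract :=
  e.contMDiff.continuous.subtype_mk _

/-- The inclusion of the space of fixed points. -/
def val (y : e.Fixed) : G.carrier := y.1

lemma continuous_val : Continuous e.val :=
  continuous_subtype_val

lemma continuous_mul_left (a : G.carrier) : Continuous (a * ·) :=
  (contMDiff_const.mul contMDiff_id : ContMDiff (𝓡 G.dim) (𝓡 G.dim) ∞ (a * ·)).continuous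

/-- The transitive family of translations of the space of fixed points. -/
def translate (a b : G.carrier) : e.Fixed ≃ₜ e.Fixed where
  toFun y := e.retract (a * b⁻¹ * y.1)
  invFun y := e.retract (b * a⁻¹ * y.1)
  left_inv y := by
    apply Subtype.ext
    change e.toFun (b * a⁻¹ * e.toFun (a * b⁻¹ * y.1)) = y.1
    -- The inner retraction can be dropped, since it does not change the class; the two translations
    -- then cancel.
    rw [e.mul (rfl : e.toFun (b * a⁻¹) = _) (e.idem (a * b⁻¹ * y.1))]
    simpa [mul_assoc] using y.2
  right_inv y := by
    apply Subtype.ext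
    change e.toFun (a * b⁻¹ * e.toFun (b * a⁻¹ * y.1)) = y.1
    rw [e.mul (rfl : e.toFun (a * b⁻¹) = _) (e.idem (b * a⁻¹ * y.1))]
    simpa [mul_assoc] using y.2
  continuous_toFun := e.continuous_retract.comp ((continuous_mul_left _).comp e.continuous_val)
  continuous_invFun := e.continuous_retract.comp ((continuous_mul_left _).comp e.continuous_val)

/-- A slice around the image of the unit. -/
def slice : FixedSlice G.dim e.toFun (e.toFun 1) :=
  (FixedSlice.exists_of_idempotent e.contMDiff e.idem (e.idem 1)).some

/-- The chart of the space of fixed points around the image of the unit. -/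
def baseChart : OpenPartialHomeomorph e.Fixed (EuclideanSpace ℝ (Fin e.slice.dim)) where
  toFun y := e.slice.proj (e.slice.chart y.1)
  invFun w := e.retract (e.slice.chart.symm (e.slice.incl w))
  source := {y | y.1 ∈ e.slice.chart.source}
  target := {w | e.slice.incl w ∈ e.slice.chart.target}
  map_source' y hy := by
    have h := (e.slice.fixed_iff _ hy).1 y.2
    simpa [h] using e.slice.chart.map_source hy
  map_target' w hw := by
    have h := (e.slice.fixed_iff _ (e.slice.chart.map_target hw)).2
      (by rw [e.slice.chart.right_inv hw, e.slice.proj_incl])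
    change e.toFun _ ∈ e.slice.chart.source
    rw [h]
    exact e.slice.chart.map_target hw
  left_inv' y hy := by
    apply Subtype.ext
    change e.toFun _ = _
    rw [(e.slice.fixed_iff _ hy).1 y.2, e.slice.chart.left_inv hy]
    exact y.2
  right_inv' w hw := by
    have h := (e.slice.fixed_iff _ (e.slice.chart.map_target hw)).2
      (by rw [e.slice.chart.right_inv hw, e.slice.proj_incl])
    change e.slice.proj (e.slice.chart (e.toFun _)) = w
    rw [h, e.slice.chart.right_inv hw, e.slice.proj_incl]
  open_source := e.slice.chart.open_source.preimage e.continuous_val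
  open_target := e.slice.chart.open_target.preimage e.slice.incl.continuous
  continuousOn_toFun := e.slice.proj.continuous.comp_continuousOn
    (e.slice.chart.continuousOn.comp e.continuous_val.continuousOn fun _ h => h)
  continuousOn_invFun := e.continuous_retract.comp_continuousOn
    (e.slice.chart.continuousOn_symm.comp e.slice.incl.continuous.continuousOn fun _ h => h)

/-- The chart of the space of fixed points around `g`. -/
def chart (g : e.Fixed) : OpenPartialHomeomorph e.Fixed (EuclideanSpace ℝ (Fin e.slice.dim)) :=
  (e.translate (e.toFun 1) g.1).transOpenPartialHomeomorph e.baseChart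

lemma mem_chart_source (g : e.Fixed) : g ∈ (e.chart g).source := by
  change e.toFun (e.toFun 1 * g.1⁻¹ * g.1) ∈ e.slice.chart.source
  rw [inv_mul_cancel_right, e.idem]
  exact e.slice.mem_source

/-- All charts are translates of one slice chart, so they share a model space. For a general smooth
idempotent the dimension of the fixed points could vary between components. -/
instance : ChartedSpace (EuclideanSpace ℝ (Fin e.slice.dim)) e.Fixed where
  atlas := Set.range e.chart
  chartAt := e.chart
  mem_chart_source := e.mem_chart_source
  chart_mem_atlas g := ⟨g, rfl⟩

/-- The extension of a chart of the space of fixed points to the group. -/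
def chartFun (g : G.carrier) (y : G.carrier) : EuclideanSpace ℝ (Fin e.slice.dim) :=
  e.slice.proj (e.slice.chart (e.toFun (e.toFun 1 * g⁻¹ * y)))

/-- The inverse of a chart of the space of fixed points, as a map to the group. -/
def chartInv (g : G.carrier) (w : EuclideanSpace ℝ (Fin e.slice.dim)) : G.carrier :=
  e.toFun (g * (e.toFun 1)⁻¹ * e.toFun (e.slice.chart.symm (e.slice.incl w)))

lemma contMDiffOn_chartFun (g : G.carrier) :
    ContMDiffOn (𝓡 G.dim) (𝓡 e.slice.dim) ∞ (e.chartFun g)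
      {y | e.toFun (e.toFun 1 * g⁻¹ * y) ∈ e.slice.chart.source} := by
  refine e.slice.proj.contDiff.contMDiff.comp_contMDiffOn ?_
  refine (contMDiffOn_of_mem_maximalAtlas e.slice.chart_mem).comp ?_ fun y hy => hy
  exact (e.contMDiff.comp (contMDiff_const.mul contMDiff_id)).contMDiffOn

lemma contMDiffOn_chartInv (g : G.carrier) :
    ContMDiffOn (𝓡 e.slice.dim) (𝓡 G.dim) ∞ (e.chartInv g)
      {w | e.slice.incl w ∈ e.slice.chart.target} := by
  refine e.contMDiff.comp_contMDiffOn (contMDiffOn_const.mul (e.contMDiff.comp_contMDiffOn ?_))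
  exact (contMDiffOn_symm_of_mem_maximalAtlas e.slice.chart_mem).comp
    e.slice.incl.contDiff.contMDiff.contMDiffOn fun w hw => hw

/-- A change of charts is `chartFun` after `chartInv`. It passes through the ambient group, where
smoothness is already known. -/
instance : IsManifold (𝓡 e.slice.dim) ∞ e.Fixed := by
  refine isManifold_of_contDiffOn _ _ _ ?_
  rintro _ _ ⟨g, rfl⟩ ⟨g', rfl⟩
  refine contMDiffOn_iff_contDiffOn.1 ?_
  refine (e.contMDiffOn_chartFun g'.1).comp
    ((e.contMDiffOn_chartInv g.1).mono ?_) ?_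
  · exact fun w hw => hw.1.1
  · exact fun w hw => hw.1.2

lemma contMDiff_val : ContMDiff (𝓡 e.slice.dim) (𝓡 G.dim) ∞
    e.val := by
  intro g
  have h : ContMDiffOn (𝓡 e.slice.dim) (𝓡 G.dim) ∞ (e.chartInv g.1 ∘ e.chart g)
      (e.chart g).source :=
    (e.contMDiffOn_chartInv g.1).comp (contMDiffOn_chart (x := g))
      fun y hy => (e.chart g).map_source hy
  refine (h.contMDiffAt ((e.chart g).open_source.mem_nhds
    (e.mem_chart_source g))).congr_of_eventuallyEq ?_
  filter_upwards [(e.chart g).open_source.mem_nhds (e.mem_chart_source g)] with y hy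
  exact (congrArg Subtype.val ((e.chart g).left_inv hy)).symm

lemma contMDiff_retract : ContMDiff (𝓡 G.dim) (𝓡 e.slice.dim) ∞ e.retract := by
  intro y
  set g := e.retract y
  have ho : IsOpen (e.retract ⁻¹' (e.chart g).source) :=
    (e.chart g).open_source.preimage e.continuous_retract
  have hy : y ∈ e.retract ⁻¹' (e.chart g).source := e.mem_chart_source g
  have h : ContMDiffOn (𝓡 G.dim) (𝓡 e.slice.dim) ∞
      ((e.chart g).symm ∘ e.chartFun g.1 ∘ e.toFun) (e.retract ⁻¹' (e.chart g).source) := by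
    refine (contMDiffOn_chart_symm (x := g)).comp ((e.contMDiffOn_chartFun g.1).comp
      e.contMDiff.contMDiffOn fun z hz => hz) fun z hz => (e.chart g).map_source hz
  refine (h.contMDiffAt (ho.mem_nhds hy)).congr_of_eventuallyEq ?_
  filter_upwards [ho.mem_nhds hy] with z hz
  exact ((e.chart g).left_inv hz).symm

/-- The quotient manifold of a Lie group by a smooth congruence. -/
def quotient : SmthMfd.{u} where
  carrier := e.Fixed
  dim := e.slice.dim

/-- The projection onto the quotient manifold. -/
def proj : G.toSmthMfd ⟶ e.quotient := ⟨e.retract, e.contMDiff_retract⟩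

/-- The canonical section of the projection onto the quotient manifold. -/
def lift : e.quotient ⟶ G.toSmthMfd := ⟨e.val, e.contMDiff_val⟩

/-- The factor `y * (e y)⁻¹` is congruent to the unit, so multiplying by it preserves classes. It
moves `e y` to `y`, which gives a section through `y`. -/
lemma toFun_mul_inv_mul (y : G.carrier) (z : e.Fixed) :
    e.toFun (y * (e.toFun y)⁻¹ * z.1) = z.1 := by
  have h : e.toFun (y * (e.toFun y)⁻¹) = e.toFun 1 := by
    rw [e.mul (e.idem y).symm rfl, mul_inv_cancel]
  rw [e.mul h rfl, one_mul]
  exact z.2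

/-- The projection onto the quotient manifold is a surjective submersion. -/
lemma isSurjSubmersion_proj : SmthMfd.IsSurjSubmersion e.proj := by
  refine ⟨fun z => ⟨z.1, Subtype.ext z.2⟩, SmthMfd.isSubmersion_of_sections _ fun y => ?_⟩
  refine ⟨⟨fun z => y * (e.toFun y)⁻¹ * z.1, contMDiff_const.mul e.contMDiff_val⟩, ?_, fun z => ?_⟩
  · exact inv_mul_cancel_right _ _
  · exact Subtype.ext (e.toFun_mul_inv_mul y z)

end SmoothCongruence

/-! ### Cones over horn diagrams in terms of faces. -/

section HornFaces

variable {C : Type w} [Category.{v} C] {n : ℕ} {k : Fin (n + 2)}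

/-- The `i`-th face of the horn `Λ[n + 1, k]`, as an object of its category of simplices. -/
def hornFace {i : Fin (n + 2)} (hi : i ≠ k) : (SSet.horn.{0} (n + 1) k : SSet.{0}).Elements :=
  ⟨op ⦋n⦌, ⟨SSet.stdSimplex.objEquiv.symm (SimplexCategory.δ i),
    (SSet.objEquiv_symm_δ_mem_horn_iff i k).2 hi⟩⟩

/-- The morphism of simplices of a horn given by a factorization through a face. -/
def homOfHornFace {i : Fin (n + 2)} (hi : i ≠ k)
    (x : (SSet.horn.{0} (n + 1) k : SSet.{0}).Elements) (f : x.1.unop ⟶ ⦋n⦌)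
    (h : f ≫ SimplexCategory.δ i = SSet.stdSimplex.objEquiv x.2.1) : hornFace hi ⟶ x :=
  CategoryOfElements.homMk (hornFace hi) x f.op
    (Subtype.ext (SSet.stdSimplex.objEquiv.injective h))

/-- A simplex of the horn misses some vertex other than `k`, and so lies in the face opposite to it.
-/
lemma exists_hornFace_factor (x : (SSet.horn.{0} (n + 1) k : SSet.{0}).Elements) :
    ∃ (i : Fin (n + 2)) (_ : i ≠ k) (f : x.1.unop ⟶ ⦋n⦌),
      f ≫ SimplexCategory.δ i = SSet.stdSimplex.objEquiv x.2.1 := by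
  obtain ⟨⟨p⟩, x, hx⟩ := x
  induction p using SimplexCategory.rec with
  | _ d =>
    rw [SSet.mem_horn_iff, Set.ne_univ_iff_exists_notMem] at hx
    obtain ⟨j, hj⟩ := hx
    simp only [Set.mem_union, Set.mem_range, Set.mem_singleton_iff, not_or, not_exists] at hj
    exact ⟨j, hj.2, _, SimplexCategory.factor_δ_spec (SSet.stdSimplex.objEquiv x) j hj.1⟩

variable {X : SimplicialObject C}

lemma cone_π_app_eq (c : Cone (matchingDiagram (SSet.horn.{0} (n + 1) k : SSet.{0}) X))
    {i : Fin (n + 2)} (hi : i ≠ k) (x : (SSet.horn.{0} (n + 1) k : SSet.{0}).Elements)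
    (f : x.1.unop ⟶ ⦋n⦌) (h : f ≫ SimplexCategory.δ i = SSet.stdSimplex.objEquiv x.2.1) :
    c.π.app x = c.π.app (hornFace hi) ≫ X.map f.op :=
  (c.w (homOfHornFace hi x f h)).symm

/-- Both composites are the component of the cone at the common simplex of the two faces. -/
lemma cone_π_hornFace_compatible
    (c : Cone (matchingDiagram (SSet.horn.{0} (n + 1) k : SSet.{0}) X))
    {i j : Fin (n + 2)} (hi : i ≠ k) (hj : j ≠ k) {p : SimplexCategory} (f g : p ⟶ ⦋n⦌)
    (h : f ≫ SimplexCategory.δ i = g ≫ SimplexCategory.δ j) :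
    c.π.app (hornFace hi) ≫ X.map f.op = c.π.app (hornFace hj) ≫ X.map g.op := by
  let x : (SSet.horn.{0} (n + 1) k : SSet.{0}).Elements :=
    ⟨op p, (SSet.horn.{0} (n + 1) k : SSet.{0}).map f.op (hornFace hi).2⟩
  exact (cone_π_app_eq c hi x f rfl).symm.trans (cone_π_app_eq c hj x g h.symm)

/-- Two cones over a horn diagram with the same faces agree. -/
lemma cone_π_ext {c c' : Cone (matchingDiagram (SSet.horn.{0} (n + 1) k : SSet.{0}) X)} {T : C}
    (f : T ⟶ c.pt) (f' : T ⟶ c'.pt)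
    (h : ∀ (i : Fin (n + 2)) (hi : i ≠ k),
      f ≫ c.π.app (hornFace hi) = f' ≫ c'.π.app (hornFace hi))
    (x : (SSet.horn.{0} (n + 1) k : SSet.{0}).Elements) : f ≫ c.π.app x = f' ≫ c'.π.app x := by
  obtain ⟨i, hi, g, hg⟩ := exists_hornFace_factor x
  rw [cone_π_app_eq c hi x g hg, cone_π_app_eq c' hi x g hg]
  exact (Category.assoc _ _ _).symm.trans
    ((congrArg (· ≫ X.map g.op) (h i hi)).trans (Category.assoc _ _ _))

/-- The projection of the matching object of a horn to the `i`-th face. -/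
def MatchingObject.face (M : MatchingObject (SSet.horn.{0} (n + 1) k : SSet.{0}) X)
    {i : Fin (n + 2)} (hi : i ≠ k) : M.cone.pt ⟶ X _⦋n⦌ :=
  M.cone.π.app (hornFace hi)

/-- Morphisms to the matching object of a horn are determined by their faces. -/
lemma MatchingObject.hom_ext_faces
    (M : MatchingObject (SSet.horn.{0} (n + 1) k : SSet.{0}) X) {T : C} {f g : T ⟶ M.cone.pt}
    (h : ∀ (i : Fin (n + 2)) (hi : i ≠ k), f ≫ M.face hi = g ≫ M.face hi) : f = g :=
  M.isLimit.hom_ext (cone_π_ext f g h)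

lemma MatchingObject.fromSimplex_face
    (M : MatchingObject (SSet.horn.{0} (n + 1) k : SSet.{0}) X) {i : Fin (n + 2)} (hi : i ≠ k) :
    M.fromSimplex ≫ M.face hi = X.δ i :=
  M.fromSimplex_π (hornFace hi)

lemma MatchingObject.map_face {Y : SimplicialObject C}
    (M : MatchingObject (SSet.horn.{0} (n + 1) k : SSet.{0}) X)
    (N : MatchingObject (SSet.horn.{0} (n + 1) k : SSet.{0}) Y) (f : X ⟶ Y)
    {i : Fin (n + 2)} (hi : i ≠ k) : M.map N f ≫ N.face hi = M.face hi ≫ f.app (op ⦋n⦌) :=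
  M.map_π N f (hornFace hi)

lemma MatchingObject.face_compatible
    (M : MatchingObject (SSet.horn.{0} (n + 1) k : SSet.{0}) X)
    {i j : Fin (n + 2)} (hi : i ≠ k) (hj : j ≠ k) {p : SimplexCategory} (f g : p ⟶ ⦋n⦌)
    (h : f ≫ SimplexCategory.δ i = g ≫ SimplexCategory.δ j) :
    M.face hi ≫ X.map f.op = M.face hj ≫ X.map g.op :=
  cone_π_hornFace_compatible M.cone hi hj f g h

end HornFaces

/-! ### The quotient manifold as matching object of a horn. -/

namespace SimplicialLieGroup

variable {G : SimplicialLieGroup.{u}} {n : ℕ} {k : Fin (n + 2)}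

/-- A compatible family of morphisms to `Gₙ`, consisting of the faces of a horn. -/
def HomCompatible {T : SmthMfd.{u}} (x : ∀ i : Fin (n + 2), i ≠ k → (T ⟶ G.toMfd _⦋n⦌)) : Prop :=
  ∀ ⦃i j : Fin (n + 2)⦄ (hi : i ≠ k) (hj : j ≠ k) ⦃p : SimplexCategory⦄ (f g : p ⟶ ⦋n⦌),
    f ≫ SimplexCategory.δ i = g ≫ SimplexCategory.δ j →
      x i hi ≫ G.toMfd.map f.op = x j hj ≫ G.toMfd.map g.op

/-- The pointwise values of a family of morphisms to `Gₙ`. -/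
def evalFaces {T : SmthMfd.{u}} (x : ∀ i : Fin (n + 2), i ≠ k → (T ⟶ G.toMfd _⦋n⦌))
    (t : T.carrier) (i : Fin (n + 2)) : (G.obj (op ⦋n⦌)).carrier :=
  if hi : i ≠ k then SmthMfd.toFun (x i hi) t else 1

lemma HomCompatible.evalFaces {T : SmthMfd.{u}}
    {x : ∀ i : Fin (n + 2), i ≠ k → (T ⟶ G.toMfd _⦋n⦌)} (hx : HomCompatible x)
    (t : T.carrier) : HornCompatible k (evalFaces x t) := by
  intro i j hi hj p f g h
  simp only [SimplicialLieGroup.evalFaces, dif_pos hi, dif_pos hj]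
  exact congrArg (fun s => SmthMfd.toFun s t) (hx hi hj f g h)

/-- The filler of a family of horns depending smoothly on parameters. -/
def fillHom {T : SmthMfd.{u}} (x : ∀ i : Fin (n + 2), i ≠ k → (T ⟶ G.toMfd _⦋n⦌)) :
    T ⟶ G.toMfd _⦋n + 1⦌ :=
  ⟨fun t => fill k (evalFaces x t), contMDiff_fill k fun i => by
    by_cases hi : i ≠ k
    · simp only [evalFaces, dif_pos hi]
      exact (x i hi).2
    · simp only [evalFaces, dif_neg hi]
      exact contMDiff_const⟩

lemma fillHom_δ {T : SmthMfd.{u}} {x : ∀ i : Fin (n + 2), i ≠ k → (T ⟶ G.toMfd _⦋n⦌)}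
    (hx : HomCompatible x) {i : Fin (n + 2)} (hi : i ≠ k) :
    fillHom x ≫ G.toMfd.δ i = x i hi := by
  refine ContMDiffMap.ext fun t => ?_
  exact (act_δ_fill (hx.evalFaces t) hi).trans (dif_pos hi)

lemma homCompatible_cone
    (c : Cone (matchingDiagram (SSet.horn.{0} (n + 1) k : SSet.{0}) G.toMfd)) :
    HomCompatible fun (i : Fin (n + 2)) (hi : i ≠ k) => c.π.app (hornFace hi) :=
  fun _ _ hi hj _ f g h => cone_π_hornFace_compatible c hi hj f g h

variable (G k)

/-- The congruence on `Gₙ₊₁` that identifies simplices with the same `k`-th horn. -/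
def hornCongruence : SmoothCongruence (G.obj (op ⦋n + 1⦌)) where
  toFun := G.hornRetraction k
  contMDiff := contMDiff_hornRetraction k
  idem _ := hornRetraction_congr fun _ hi => act_δ_hornRetraction hi _
  -- Faces are homomorphisms, and the retraction preserves those other than the `k`-th; hence
  -- classes determine the faces of a product.
  mul a a' b b' ha hb := hornRetraction_congr fun i hi => by
    rw [map_mul, map_mul, ← act_δ_hornRetraction hi a, ← act_δ_hornRetraction hi b, ha, hb,
      act_δ_hornRetraction, act_δ_hornRetraction] <;> exact hi

/-- The cone that exhibits the quotient manifold of `Gₙ₊₁` as a matching object. -/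
def hornCone : Cone (matchingDiagram (SSet.horn.{0} (n + 1) k : SSet.{0}) G.toMfd) :=
  (simplexCone (SSet.horn.{0} (n + 1) k) G.toMfd).extend (G.hornCongruence k).lift

variable {G k}

lemma proj_lift_δ {T : SmthMfd.{u}} (f : T ⟶ G.toMfd _⦋n + 1⦌) {i : Fin (n + 2)} (hi : i ≠ k) :
    (f ≫ (G.hornCongruence k).proj) ≫ (G.hornCongruence k).lift ≫ G.toMfd.δ i =
      f ≫ G.toMfd.δ i :=
  ContMDiffMap.ext fun t => act_δ_hornRetraction hi (SmthMfd.toFun f t)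

/-- A point of the quotient is a fixed point of the retraction, which depends on the horn alone.
This is the uniqueness half of the universal property. -/
lemma hom_quotient_ext {T : SmthMfd.{u}} {f g : T ⟶ (G.hornCongruence k).quotient}
    (h : ∀ i, i ≠ k → f ≫ (G.hornCongruence k).lift ≫ G.toMfd.δ i =
      g ≫ (G.hornCongruence k).lift ≫ G.toMfd.δ i) : f = g := by
  refine ContMDiffMap.ext fun t => Subtype.ext ?_
  refine (f.1 t).2.symm.trans (Eq.trans ?_ (g.1 t).2)
  exact hornRetraction_congr fun i hi => congrArg (fun s => SmthMfd.toFun s t) (h i hi)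

variable (G k)

/-- The quotient manifold of `Gₙ₊₁` is the matching object of `G` at the horn `Λ[n + 1, k]`. -/
def hornMatchingObject :
    MatchingObject (SSet.horn.{0} (n + 1) k : SSet.{0}) G.toMfd where
  cone := G.hornCone k
  isLimit :=
    { lift := fun c => fillHom (fun i (hi : i ≠ k) => c.π.app (hornFace hi)) ≫
        (G.hornCongruence k).proj
      fac := fun c => by
        refine fun x => (cone_π_ext (c' := c) _ (𝟙 _) (fun i hi => ?_) x).trans
          (Category.id_comp _)
        exact (proj_lift_δ _ hi).trans ((fillHom_δ (homCompatible_cone c) hi).trans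
          (Category.id_comp _).symm)
      uniq := fun c m hm => by
        refine hom_quotient_ext fun i hi => (hm (hornFace hi)).trans ?_
        exact ((proj_lift_δ _ hi).trans (fillHom_δ (homCompatible_cone c) hi)).symm }

lemma hornMatchingObject_fromSimplex :
    (G.hornMatchingObject k).fromSimplex = (G.hornCongruence k).proj := by
  refine MatchingObject.hom_ext_faces _ fun i hi => ?_
  refine (MatchingObject.fromSimplex_face _ hi).trans ?_
  exact (proj_lift_δ (𝟙 (G.toMfd _⦋n + 1⦌)) hi).symm

lemma isSurjSubmersion_hornMatchingObject :
    SmthMfd.IsSurjSubmersion (G.hornMatchingObject k).fromSimplex := by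
  rw [hornMatchingObject_fromSimplex]
  exact (G.hornCongruence k).isSurjSubmersion_proj

end SimplicialLieGroup

/-! ### Representability of matching sheaves relative to the point. -/

namespace SmthMfd

/-- The unique morphism of presheaves to the presheaf represented by the point. -/
def toYonedaPoint (F : MfdPsh.{u}) : F ⟶ yoneda.obj point.{u} where
  app T := TypeCat.ofHom fun _ => toPoint T.unop
  naturality _ _ _ := by ext; exact hom_point_ext _ _

lemma hom_yoneda_point_ext {F : MfdPsh.{u}} (f g : F ⟶ yoneda.obj point.{u}) : f = g := by
  refine NatTrans.ext (funext fun T => ?_)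
  ext x
  exact hom_point_ext _ _

end SmthMfd

instance isIso_fromSimplex_point {n : ℕ} (K : (Δ[n] : SSet.{0}).Subcomplex) :
    IsIso (SimplicialMfd.matchingPsh (K : SSet.{0})
      ((SimplicialObject.const SmthMfd.{u}).obj SmthMfd.point.{u})).fromSimplex :=
  ⟨SmthMfd.toYonedaPoint _, SmthMfd.hom_yoneda_point_ext _ _,
    (SimplicialMfd.matchingPsh _ _).isLimit.hom_ext fun _ => SmthMfd.hom_yoneda_point_ext _ _⟩

/-- If the matching object at `K` exists as a manifold, then it represents the matching object of
sheaves. -/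
def MatchingObject.yonedaIso {K : SSet.{0}} {X : SimplicialMfd.{u}} (M : MatchingObject K X) :
    yoneda.obj M.cone.pt ≅ (SimplicialMfd.matchingPsh K X).cone.pt :=
  (isLimitOfPreserves yoneda M.isLimit).conePointUniqueUpToIso
    (SimplicialMfd.matchingPsh K X).isLimit

lemma MatchingObject.yonedaIso_hom_π {K : SSet.{0}} {X : SimplicialMfd.{u}}
    (M : MatchingObject K X) (x : K.Elements) :
    M.yonedaIso.hom ≫ (SimplicialMfd.matchingPsh K X).cone.π.app x =
      yoneda.map (M.cone.π.app x) :=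
  IsLimit.conePointUniqueUpToIso_hom_comp _ _ _

lemma MatchingObject.map_fromSimplex_yonedaIso {n : ℕ} {K : (Δ[n] : SSet.{0}).Subcomplex}
    {X : SimplicialMfd.{u}} (M : MatchingObject (K : SSet.{0}) X) :
    yoneda.map M.fromSimplex ≫ M.yonedaIso.hom =
      (SimplicialMfd.matchingPsh (K : SSet.{0}) X).fromSimplex := by
  refine (SimplicialMfd.matchingPsh (K : SSet.{0}) X).isLimit.hom_ext fun x => ?_
  rw [Category.assoc, yonedaIso_hom_π]
  exact ((yoneda.map_comp _ _).symm.trans (congrArg yoneda.map (M.fromSimplex_π x))).trans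
    ((SimplicialMfd.matchingPsh (K : SSet.{0}) X).fromSimplex_π x).symm

lemma isRepresentableSurjSubmersion_toPoint {n : ℕ} {K : (Δ[n] : SSet.{0}).Subcomplex}
    {X : SimplicialMfd.{u}} (M : MatchingObject (K : SSet.{0}) X)
    (h : SmthMfd.IsSurjSubmersion M.fromSimplex) :
    IsRepresentableSurjSubmersion
      (SimplicialMfd.relMatchingMap (SimplicialMfd.toPoint X) K) := by
  -- Over the point the second projection is a base change of an isomorphism, so the relative
  -- matching object is the absolute one.
  refine ⟨M.cone.pt, M.yonedaIso ≪≫ (asIso (pullback.snd _ _)).symm, M.fromSimplex, ?_, h⟩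
  rw [Iso.trans_hom, Iso.symm_hom, asIso_inv, ← Category.assoc, IsIso.comp_inv_eq,
    M.map_fromSimplex_yonedaIso]
  exact (pullback.lift_snd _ _ _).symm

/-! ### Simplicial Lie groups are Lie ∞-groupoids. -/

namespace SimplicialLieGroup

variable (G : SimplicialLieGroup.{u})

lemma isSubmersion_δ (n : ℕ) (i : Fin (n + 2)) : SmthMfd.IsSubmersion (G.toMfd.δ i) := by
  -- Any `k ≠ i` will do; it only serves to select a degeneracy that is a section of the face.
  -- Translating that degeneracy moves the section through a given `x`.
  obtain ⟨k, hk⟩ := exists_ne i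
  let σ := G.act (SimplexCategory.σ (fillDegeneracy k i))
  let δ := G.act (SimplexCategory.δ i)
  have hs : ∀ x : (G.obj (op ⦋n + 1⦌)).carrier, ContMDiff (𝓡 (G.obj (op ⦋n⦌)).dim)
      (𝓡 (G.obj (op ⦋n + 1⦌)).dim) ∞ fun y => x * σ ((δ x)⁻¹ * y) := fun x =>
    contMDiff_const.mul ((contMDiff_act G _).comp (contMDiff_const.mul contMDiff_id))
  refine SmthMfd.isSubmersion_of_sections _ fun (x : (G.obj (op ⦋n + 1⦌)).carrier) =>
    ⟨⟨_, hs x⟩, ?_, fun (y : (G.obj (op ⦋n⦌)).carrier) => ?_⟩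
  · change x * σ ((δ x)⁻¹ * δ x) = x
    rw [inv_mul_cancel, map_one, mul_one]
  · change δ (x * σ ((δ x)⁻¹ * y)) = y
    rw [map_mul, ← act_comp, δ_comp_σ_fillDegeneracy hk.symm, act_id, mul_inv_cancel_left]

lemma isSurjSubmersion_toPoint (p : SimplexCategoryᵒᵖ) :
    SmthMfd.IsSurjSubmersion (SmthMfd.toPoint (G.toMfd.obj p)) :=
  ⟨fun _ => ⟨(1 : (G.obj p).carrier), rfl⟩, SmthMfd.isSubmersion_of_sections _ fun x =>
    ⟨ContMDiffMap.const x, rfl, fun _ => rfl⟩⟩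

lemma isLieInfinityGroupoid : IsLieInfinityGroupoid G.toMfd :=
  ⟨⟨G.isSurjSubmersion_toPoint _, fun _ k => isRepresentableSurjSubmersion_toPoint
    (G.hornMatchingObject k) (G.isSurjSubmersion_hornMatchingObject k)⟩, G.isSubmersion_δ⟩

end SimplicialLieGroup

/-! ### The square comparing horns with horns of the décalage. -/

section Decalage

lemma joinPointHom_δ {n : ℕ} (i : Fin (n + 2)) (a : Fin (n + 2)) :
    joinPointHom (SimplexCategory.δ i).toOrderHom a = i.castSucc.succAbove a := by
  induction a using Fin.lastCases with
  | last =>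
    rw [Fin.succAbove_of_le_castSucc _ _ (Fin.castSucc_le_castSucc_iff.2 (Fin.le_last i)),
      Fin.succ_last]
    exact joinPointHom_last _
  | cast a =>
    rw [Fin.castSucc_succAbove_castSucc]
    exact joinPointHom_castSucc _ _

lemma joinPoint_map_δ {n : ℕ} (i : Fin (n + 2)) :
    joinPoint.map (SimplexCategory.δ i) = SimplexCategory.δ i.castSucc := by
  ext a : 3
  exact joinPointHom_δ i a

variable {C : Type w} [Category.{v} C] {n : ℕ} {k : Fin (n + 2)} {X : SimplicialObject C}

lemma last_ne_castSucc (k : Fin (n + 2)) : Fin.last (n + 2) ≠ k.castSucc :=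
  (Fin.castSucc_lt_last k).ne'

lemma castSucc_ne_castSucc {i : Fin (n + 2)} (hi : i ≠ k) : i.castSucc ≠ k.castSucc :=
  fun h => hi (Fin.castSucc_injective _ h)

lemma dec_map_δ (X : SimplicialObject C) (i : Fin (n + 2)) :
    (dec X).map (SimplexCategory.δ i).op = X.δ i.castSucc :=
  congrArg (fun t : ⦋n + 1⦌ ⟶ ⦋n + 2⦌ => X.map t.op) (joinPoint_map_δ i)

lemma MatchingObject.toDec_face
    (M : MatchingObject (SSet.horn.{0} (n + 2) k.castSucc : SSet.{0}) X)
    (D : MatchingObject (SSet.horn.{0} (n + 1) k : SSet.{0}) (dec X)) {i : Fin (n + 2)}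
    (hi : i ≠ k) : M.toDec k D ≫ D.face hi = M.face (castSucc_ne_castSucc hi) := by
  let π : ∀ y : (SSet.horn.{0} (n + 2) k.castSucc : SSet.{0}).obj (op ⦋n + 1⦌),
    M.cone.pt ⟶ X _⦋n + 1⦌ := fun y => M.cone.π.app ⟨op ⦋n + 1⦌, y⟩
  refine (D.isLimit.fac _ (hornFace hi)).trans
    (congrArg π (Subtype.ext (SSet.stdSimplex.objEquiv.injective ?_)))
  exact joinPoint_map_δ i

lemma MatchingObject.toLastFace_eq_face
    (M : MatchingObject (SSet.horn.{0} (n + 2) k.castSucc : SSet.{0}) X) :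
    M.toLastFace = M.face (last_ne_castSucc k) := rfl

/-- On each face the square reduces to the simplicial identity between that face and the last one.
-/
lemma MatchingObject.toLastFace_fromSimplex
    (M : MatchingObject (SSet.horn.{0} (n + 2) k.castSucc : SSet.{0}) X)
    (N : MatchingObject (SSet.horn.{0} (n + 1) k : SSet.{0}) X)
    (D : MatchingObject (SSet.horn.{0} (n + 1) k : SSet.{0}) (dec X)) :
    M.toLastFace ≫ N.fromSimplex = M.toDec k D ≫ D.map N (decTo X) := by
  refine N.hom_ext_faces fun i hi => ?_
  rw [Category.assoc, Category.assoc, fromSimplex_face, map_face, toLastFace_eq_face]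
  refine Eq.trans ?_ ((congrArg (· ≫ (decTo X).app (op ⦋n⦌)) (M.toDec_face D hi)).symm.trans
    (Category.assoc _ _ _))
  exact M.face_compatible _ _ _ _ (SimplexCategory.δ_comp_δ (Fin.le_last i))

end Decalage

namespace SimplicialLieGroup

variable {G : SimplicialLieGroup.{u}} {n : ℕ}

/-- To be compatible, it suffices to satisfy the simplicial identities for faces. -/
lemma homCompatible_of_δ {k : Fin (n + 3)} {T : SmthMfd.{u}}
    {x : ∀ i : Fin (n + 3), i ≠ k → (T ⟶ G.toMfd _⦋n + 1⦌)}
    (h : ∀ (i : Fin (n + 2)) (j : Fin (n + 3)) (hij : i.castSucc < j) (hi : i.castSucc ≠ k)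
      (hj : j ≠ k), x i.castSucc hi ≫ G.toMfd.δ (j.pred hij.ne_zero) = x j hj ≫ G.toMfd.δ i) :
    HomCompatible x := by
  have key : ∀ ⦃i j : Fin (n + 3)⦄ (_ : i < j) (hi : i ≠ k) (hj : j ≠ k),
      ∀ ⦃p : SimplexCategory⦄ (f g : p ⟶ ⦋n + 1⦌),
      f ≫ SimplexCategory.δ i = g ≫ SimplexCategory.δ j →
        x i hi ≫ G.toMfd.map f.op = x j hj ≫ G.toMfd.map g.op := by
    intro i j hij hi hj p f g hfg
    obtain ⟨i, rfl⟩ := i.eq_castSucc_of_ne_last (Fin.ne_last_of_lt hij)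
    obtain ⟨e, rfl, rfl⟩ := SimplexCategory.exists_factor_of_comp_δ_eq hij f g hfg
    have := congrArg (· ≫ G.toMfd.map e.op) (h i j hij hi hj)
    simpa [SimplicialObject.δ] using this
  intro i j hi hj p f g hfg
  rcases lt_trichotomy i j with hij | rfl | hij
  · exact key hij hi hj f g hfg
  · rw [(cancel_mono _).1 hfg]
  · exact (key hij hj hi g f hfg.symm).symm

/-- A one-dimensional horn has a single face, and face inclusions are monic. -/
lemma homCompatible_of_fin_two {k : Fin 2} {T : SmthMfd.{u}}
    (x : ∀ i : Fin 2, i ≠ k → (T ⟶ G.toMfd _⦋0⦌)) : HomCompatible (n := 0) x := by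
  intro i j hi hj p f g hfg
  obtain rfl : i = j := by omega
  rw [(cancel_mono _).1 hfg]

variable {k : Fin (n + 2)}

/-- The faces of the horn `Λ[n + 2, k]` glued from a simplex and a horn of the décalage. -/
def decFaces {T : SmthMfd.{u}}
    (D : MatchingObject (SSet.horn.{0} (n + 1) k : SSet.{0}) (dec G.toMfd))
    (a : T ⟶ G.toMfd _⦋n + 1⦌) (b : T ⟶ D.cone.pt) :
    ∀ i : Fin (n + 3), i ≠ k.castSucc → (T ⟶ G.toMfd _⦋n + 1⦌) :=
  Fin.lastCases (fun _ => a) fun i hi =>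
    b ≫ D.face (i := i) fun h => hi (congrArg Fin.castSucc h)

lemma decFaces_last {T : SmthMfd.{u}}
    (D : MatchingObject (SSet.horn.{0} (n + 1) k : SSet.{0}) (dec G.toMfd))
    (a : T ⟶ G.toMfd _⦋n + 1⦌) (b : T ⟶ D.cone.pt) (h : Fin.last (n + 2) ≠ k.castSucc) :
    decFaces D a b (Fin.last (n + 2)) h = a := by
  simp [decFaces]

lemma decFaces_castSucc {T : SmthMfd.{u}}
    (D : MatchingObject (SSet.horn.{0} (n + 1) k : SSet.{0}) (dec G.toMfd))
    (a : T ⟶ G.toMfd _⦋n + 1⦌) (b : T ⟶ D.cone.pt) {i : Fin (n + 2)} (hi : i ≠ k)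
    (h : i.castSucc ≠ k.castSucc) :
    decFaces D a b i.castSucc h = b ≫ D.face hi := by
  unfold decFaces
  rw [Fin.lastCases_castSucc]
  rfl

/-- An identity involving the last face is the pullback condition read on one face; an identity
between two other faces already holds in the horn of the décalage. -/
lemma homCompatible_decFaces {T : SmthMfd.{u}}
    (N : MatchingObject (SSet.horn.{0} (n + 1) k : SSet.{0}) G.toMfd)
    (D : MatchingObject (SSet.horn.{0} (n + 1) k : SSet.{0}) (dec G.toMfd))
    (a : T ⟶ G.toMfd _⦋n + 1⦌) (b : T ⟶ D.cone.pt)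
    (h : a ≫ N.fromSimplex = b ≫ D.map N (decTo G.toMfd)) : HomCompatible (decFaces D a b) := by
  refine homCompatible_of_δ fun i j hij hi hj => ?_
  have hik : i ≠ k := fun h => hi (congrArg Fin.castSucc h)
  rw [decFaces_castSucc D a b hik]
  induction j using Fin.lastCases with
  | last =>
    rw [decFaces_last]
    have h' := congrArg (· ≫ N.face hik) h
    simp only [Category.assoc, N.fromSimplex_face, MatchingObject.map_face] at h'
    exact (Category.assoc _ _ _).trans h'.symm
  | cast j =>
    have hjk : j ≠ k := fun h => hj (congrArg Fin.castSucc h)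
    rw [decFaces_castSucc D a b hjk]
    have hij' : i < j := Fin.castSucc_lt_castSucc_iff.1 hij
    obtain _ | n := n
    -- Two distinct indices different from `k` do not exist in `Fin 2`.
    · omega
    obtain ⟨i, rfl⟩ := i.eq_castSucc_of_ne_last (Fin.ne_last_of_lt hij')
    obtain ⟨j, rfl⟩ := j.eq_succ_of_ne_zero (Fin.ne_zero_of_lt hij')
    have hD := D.face_compatible hik hjk (SimplexCategory.δ j)
      (SimplexCategory.δ i) (SimplexCategory.δ_comp_δ (Fin.castSucc_lt_succ_iff.1 hij')).symm
    rw [dec_map_δ, dec_map_δ] at hD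
    exact (Category.assoc _ _ _).trans ((congrArg (b ≫ ·) hD).trans (Category.assoc _ _ _).symm)

/-- The square that relates the horns of a simplicial Lie group to those of its décalage. -/
lemma isPullback_toLastFace
    (M : MatchingObject (SSet.horn.{0} (n + 2) k.castSucc : SSet.{0}) G.toMfd)
    (N : MatchingObject (SSet.horn.{0} (n + 1) k : SSet.{0}) G.toMfd)
    (D : MatchingObject (SSet.horn.{0} (n + 1) k : SSet.{0}) (dec G.toMfd)) :
    IsPullback M.toLastFace (M.toDec k D) N.fromSimplex (D.map N (decTo G.toMfd)) := by
  -- The glued family is filled and then restricted to its horn. The filler is auxiliary: morphisms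
  -- into `M` depend only on their faces.
  refine ⟨⟨M.toLastFace_fromSimplex N D⟩, ⟨PullbackCone.IsLimit.mk _
    (fun s => fillHom (decFaces D s.fst s.snd) ≫ M.fromSimplex) (fun s => ?_) (fun s => ?_)
    fun s m h1 h2 => ?_⟩⟩
  · have hc := homCompatible_decFaces N D s.fst s.snd s.condition
    rw [M.toLastFace_eq_face, Category.assoc, M.fromSimplex_face,
      fillHom_δ hc (last_ne_castSucc k), decFaces_last]
  · have hc := homCompatible_decFaces N D s.fst s.snd s.condition
    refine D.hom_ext_faces fun i hi => ?_
    have hi' := castSucc_ne_castSucc hi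
    let f : s.pt ⟶ G.toMfd _⦋n + 2⦌ := fillHom (decFaces D s.fst s.snd)
    have h1 : (f ≫ M.fromSimplex) ≫ M.face hi' = f ≫ G.toMfd.δ i.castSucc := by
      rw [Category.assoc, M.fromSimplex_face]
    refine (Category.assoc _ _ _).trans (Eq.trans ?_ (h1.trans ?_))
    · exact congrArg (fun t : M.cone.pt ⟶ G.toMfd _⦋n + 1⦌ => (f ≫ M.fromSimplex) ≫ t)
        (M.toDec_face D hi)
    · exact (fillHom_δ hc hi').trans (decFaces_castSucc D _ _ hi hi')
  · have hc := homCompatible_decFaces N D s.fst s.snd s.condition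
    refine M.hom_ext_faces fun i hi => ?_
    rw [Category.assoc, M.fromSimplex_face, fillHom_δ hc hi]
    induction i using Fin.lastCases with
    | last => rw [decFaces_last, ← h1, M.toLastFace_eq_face]
    | cast i =>
      have hik : i ≠ k := fun h => hi (congrArg Fin.castSucc h)
      rw [decFaces_castSucc D _ _ hik, ← h2]
      exact ((Category.assoc _ _ _).trans (congrArg (m ≫ ·) (M.toDec_face D hik))).symm

end SimplicialLieGroup

/-! ### Horns of the opposite simplicial object. -/

section Opposite

variable {C : Type w} [Category.{v} C] {n : ℕ} {X : SimplicialObject C}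

lemma MatchingObject.section_δ {k : Fin (n + 2)}
    (M : MatchingObject (SSet.horn.{0} (n + 1) k : SSet.{0}) X) {s : M.cone.pt ⟶ X _⦋n + 1⦌}
    (hs : s ≫ M.fromSimplex = 𝟙 _) {i : Fin (n + 2)} (hi : i ≠ k) : s ≫ X.δ i = M.face hi := by
  rw [← M.fromSimplex_face hi, ← Category.assoc, hs, Category.id_comp]

lemma opObjIso_inv_δ (X : SimplicialObject C) (i : Fin (n + 2)) :
    SimplicialObject.opObjIso.inv ≫ (SimplicialObject.opFunctor.obj X).δ i =
      X.δ i.rev ≫ SimplicialObject.opObjIso.inv := by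
  simp

lemma opObjIso_hom_δ (X : SimplicialObject C) (i : Fin (n + 2)) :
    SimplicialObject.opObjIso.hom ≫ X.δ i =
      (SimplicialObject.opFunctor.obj X).δ i.rev ≫ SimplicialObject.opObjIso.hom := by
  simp

/-- If the canonical morphisms to the matching objects of opposite horns are split, then the
matching objects are isomorphic. -/
lemma MatchingObject.exists_op_iso {k l : Fin (n + 2)} (hkl : l = k.rev)
    (M : MatchingObject (SSet.horn.{0} (n + 1) k : SSet.{0}) X)
    (N : MatchingObject (SSet.horn.{0} (n + 1) l : SSet.{0}) (SimplicialObject.opFunctor.obj X))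
    {s : M.cone.pt ⟶ X _⦋n + 1⦌} (hs : s ≫ M.fromSimplex = 𝟙 _)
    {t : N.cone.pt ⟶ (SimplicialObject.opFunctor.obj X) _⦋n + 1⦌}
    (ht : t ≫ N.fromSimplex = 𝟙 _) :
    ∃ e : M.cone.pt ≅ N.cone.pt,
      M.fromSimplex ≫ e.hom = SimplicialObject.opObjIso.inv ≫ N.fromSimplex := by
  subst hkl
  -- Replacing a simplex by the chosen filler of its horn can change only the `k`-th face, which
  -- becomes the omitted face after reversal.
  have hM : M.fromSimplex ≫ s ≫ SimplicialObject.opObjIso.inv ≫ N.fromSimplex =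
      SimplicialObject.opObjIso.inv ≫ N.fromSimplex := by
    refine N.hom_ext_faces fun i hi => ?_
    have hi' : i.rev ≠ k := fun h => hi (by rw [← h, Fin.rev_rev])
    simp only [Category.assoc, N.fromSimplex_face, opObjIso_inv_δ]
    rw [reassoc_of% M.section_δ hs hi', reassoc_of% M.fromSimplex_face hi']
  have hN : N.fromSimplex ≫ t ≫ SimplicialObject.opObjIso.hom ≫ M.fromSimplex =
      SimplicialObject.opObjIso.hom ≫ M.fromSimplex := by
    refine M.hom_ext_faces fun i hi => ?_
    have hi' : i.rev ≠ k.rev := fun h => hi (Fin.rev_injective h)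
    simp only [Category.assoc, M.fromSimplex_face, opObjIso_hom_δ]
    rw [reassoc_of% N.section_δ ht hi', reassoc_of% N.fromSimplex_face hi']
  refine ⟨⟨s ≫ SimplicialObject.opObjIso.inv ≫ N.fromSimplex,
    t ≫ SimplicialObject.opObjIso.hom ≫ M.fromSimplex, ?_, ?_⟩, hM⟩
  · rw [Category.assoc, Category.assoc, hN, Iso.inv_hom_id_assoc, hs]
  · rw [Category.assoc, Category.assoc, hM, Iso.hom_inv_id_assoc, ht]

end Opposite

namespace SimplicialLieGroup

variable {G : SimplicialLieGroup.{u}} {n : ℕ}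

/-- The section is Moore's filler of the universal horn, parametrized by the matching object itself.
-/
lemma exists_section_fromSimplex {k : Fin (n + 2)}
    (M : MatchingObject (SSet.horn.{0} (n + 1) k : SSet.{0}) G.toMfd) :
    ∃ s : M.cone.pt ⟶ G.toMfd _⦋n + 1⦌, s ≫ M.fromSimplex = 𝟙 _ := by
  refine ⟨fillHom fun i hi => M.face hi, M.hom_ext_faces fun i hi => ?_⟩
  rw [Category.assoc, M.fromSimplex_face, Category.id_comp]
  exact fillHom_δ (homCompatible_cone M.cone) hi

lemma exists_op_matchingObject
    (M : MatchingObject (SSet.horn.{0} (n + 1) (Fin.last (n + 1)) : SSet.{0}) G.toMfd) :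
    ∃ (N : MatchingObject (SSet.horn.{0} (n + 1) 0 : SSet.{0})
        (SimplicialObject.opFunctor.obj G.toMfd)) (e : M.cone.pt ≅ N.cone.pt),
      M.fromSimplex ≫ e.hom = SimplicialObject.opObjIso.inv ≫ N.fromSimplex := by
  let H : SimplicialLieGroup.{u} := SimplicialObject.opFunctor.obj G
  obtain ⟨s, hs⟩ := exists_section_fromSimplex M
  obtain ⟨t, ht⟩ := exists_section_fromSimplex (H.hornMatchingObject (n := n) 0)
  exact ⟨H.hornMatchingObject 0,
    MatchingObject.exists_op_iso (by simp) M (H.hornMatchingObject 0) hs ht⟩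

end SimplicialLieGroup

/-! ### Germs of smooth maps on shrinking disks. -/

section Germs

variable {X Y : SmthMfd.{u}} {m : ℕ}

/-- The germ of a smooth map defined on a disk. -/
def germ {r : ℕ} (f : Disk.toMfd.{u} m r ⟶ X) : (stalkFunctor.{u} m).obj (yoneda.obj X) :=
  colimit.ι (Disk.diagram.{u} m ⋙ yoneda.obj X) r f

lemma exists_germ_eq (x : (stalkFunctor.{u} m).obj (yoneda.obj X)) :
    ∃ (r : ℕ) (f : Disk.toMfd.{u} m r ⟶ X), germ f = x :=
  Types.jointly_surjective' (F := Disk.diagram.{u} m ⋙ yoneda.obj X) x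

lemma germ_incl {r s : ℕ} (h : r ≤ s) (f : Disk.toMfd.{u} m r ⟶ X) :
    germ (Disk.incl m h ≫ f) = germ f :=
  congrArg (fun t => t f) (congrArg TypeCat.Hom.hom
    (colimit.w (Disk.diagram.{u} m ⋙ yoneda.obj X) (homOfLE h)))

lemma exists_incl_eq_of_germ_eq {r : ℕ} {f g : Disk.toMfd.{u} m r ⟶ X} (h : germ f = germ g) :
    ∃ (s : ℕ) (hrs : r ≤ s), Disk.incl m hrs ≫ f = Disk.incl m hrs ≫ g := by
  obtain ⟨s, a, b, hab⟩ :=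
    (Types.FilteredColimit.colimit_eq_iff (Disk.diagram.{u} m ⋙ yoneda.obj X)).1 h
  exact ⟨s, leOfHom a, hab⟩

lemma stalkFunctor_map_germ {r : ℕ} (f : Disk.toMfd.{u} m r ⟶ X) (g : X ⟶ Y) :
    (stalkFunctor.{u} m).map (yoneda.map g) (germ f) = germ (f ≫ g) :=
  ConcreteCategory.congr_hom
    (ι_colimMap (Functor.whiskerLeft (Disk.diagram.{u} m) (yoneda.map g)) r) f

/-- A finite family of germs can be represented on a common disk. -/
lemma exists_forall_germ_eq {α : Type*} [Finite α]
    (x : α → (stalkFunctor.{u} m).obj (yoneda.obj X)) :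
    ∃ (r : ℕ) (f : α → (Disk.toMfd.{u} m r ⟶ X)), ∀ a, germ (f a) = x a := by
  have h : ∀ᶠ r : ℕ in Filter.atTop, ∀ a, ∃ f : Disk.toMfd.{u} m r ⟶ X, germ f = x a := by
    refine Filter.eventually_all.2 fun a => ?_
    obtain ⟨r, f, hf⟩ := exists_germ_eq (x a)
    filter_upwards [Filter.eventually_ge_atTop r] with s hs
    exact ⟨Disk.incl m hs ≫ f, (germ_incl hs f).trans hf⟩
  obtain ⟨r, hr⟩ := h.exists
  choose f hf using hr
  exact ⟨r, f, hf⟩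

/-- Finitely many equations between germs hold on a common disk. -/
lemma exists_forall_incl_eq {α : Type*} [Finite α] {r : ℕ} {f g : α → (Disk.toMfd.{u} m r ⟶ X)}
    (h : ∀ a, germ (f a) = germ (g a)) :
    ∃ (s : ℕ) (hrs : r ≤ s), ∀ a, Disk.incl m hrs ≫ f a = Disk.incl m hrs ≫ g a := by
  have h : ∀ᶠ s : ℕ in Filter.atTop, ∀ a, ∀ hrs : r ≤ s,
      Disk.incl m hrs ≫ f a = Disk.incl m hrs ≫ g a := by
    refine Filter.eventually_all.2 fun a => ?_
    obtain ⟨s, hrs, hs⟩ := exists_incl_eq_of_germ_eq (h a)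
    filter_upwards [Filter.eventually_ge_atTop s] with t ht hrt
    exact congrArg (Disk.incl m ht ≫ ·) hs
  obtain ⟨s, hs, hrs⟩ := (h.and (Filter.eventually_ge_atTop r)).exists
  exact ⟨s, hrs, fun a => hs a hrs⟩

end Germs

/-! ### Horn filling in stalks. -/

/-- The stalk of the simplicial sheaf represented by a simplicial manifold. -/
abbrev SimplicialMfd.stalk (X : SimplicialMfd.{u}) (m : ℕ) : SSet.{u} :=
  ((SimplicialObject.whiskering _ _).obj (stalkFunctor.{u} m)).obj (SimplicialMfd.toPsh X)

lemma SimplicialMfd.stalk_δ_germ (X : SimplicialMfd.{u}) {m n r : ℕ}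
    (f : Disk.toMfd.{u} m r ⟶ X _⦋n + 1⦌) (i : Fin (n + 2)) :
    (X.stalk m).δ i (germ f) = germ (f ≫ X.δ i) :=
  stalkFunctor_map_germ f (X.δ i)

lemma yonedaEquiv_δ {S : SSet.{u}} {n : ℕ} (y : Δ[n + 1] ⟶ S) (i : Fin (n + 2)) :
    S.δ i (SSet.yonedaEquiv y) = SSet.yonedaEquiv (SSet.stdSimplex.δ i ≫ y) :=
  SSet.yonedaEquiv_naturality _ _

namespace SimplicialLieGroup

variable (G : SimplicialLieGroup.{u})

/-- The stalks of a simplicial Lie group satisfy the horn filling condition. -/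
lemma exists_germ_filler {m n r : ℕ} {k : Fin (n + 2)}
    {x : ∀ i : Fin (n + 2), i ≠ k → (Disk.toMfd.{u} m r ⟶ G.toMfd _⦋n⦌)} (hx : HomCompatible x) :
    ∃ z : (G.toMfd.stalk m) _⦋n + 1⦌, ∀ (i : Fin (n + 2)) (hi : i ≠ k),
      (G.toMfd.stalk m).δ i z = germ (x i hi) :=
  ⟨germ (fillHom x), fun i hi =>
    (G.toMfd.stalk_δ_germ _ i).trans (congrArg germ (fillHom_δ hx hi))⟩

/-- A simplicial Lie group is locally fibrant. -/
lemma isLocallyFibrant : IsLocallyFibrant G.toMfd := by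
  intro m
  refine SSet.KanComplex.iff.2 fun n k y hy => ?_
  obtain ⟨r, f, hf⟩ := exists_forall_germ_eq (X := G.toMfd _⦋n⦌) (m := m)
    (α := {i : Fin (n + 2) // i ≠ k}) fun i => SSet.yonedaEquiv (y i.1 i.2)
  suffices h : ∃ z : (G.toMfd.stalk m) _⦋n + 1⦌, ∀ (i : Fin (n + 2)) (hi : i ≠ k),
      (G.toMfd.stalk m).δ i z = SSet.yonedaEquiv (y i hi) by
    obtain ⟨z, hz⟩ := h
    refine ⟨SSet.yonedaEquiv.symm z, fun i hi => ?_⟩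
    refine SSet.yonedaEquiv.injective (Eq.trans ?_ (hz i hi))
    rw [← yonedaEquiv_δ, Equiv.apply_symm_apply]
  -- Horns of dimension one impose no face identities, so no shrinking of the disk is needed.
  obtain _ | n := n
  · obtain ⟨z, hz⟩ := G.exists_germ_filler
      (homCompatible_of_fin_two fun i hi => f ⟨i, hi⟩)
    exact ⟨z, fun i hi => (hz i hi).trans (hf ⟨i, hi⟩)⟩
  -- Only finitely many pairs of faces carry identities between germs, so one smaller disk validates
  -- all of them.
  · let P := {p : {i : Fin (n + 3) // i ≠ k} × {i : Fin (n + 3) // i ≠ k} // p.1.1 < p.2.1}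
    have hδ : ∀ p : P, germ (f p.1.1 ≫ G.toMfd.δ (p.1.2.1.pred (Fin.ne_zero_of_lt p.2))) =
        germ (f p.1.2 ≫ G.toMfd.δ (p.1.1.1.castPred (Fin.ne_last_of_lt p.2))) := by
      intro ⟨⟨i, j⟩, hij⟩
      have h := congrArg SSet.yonedaEquiv (hy i.1 j.1 i.2 j.2 hij)
      rw [← yonedaEquiv_δ, ← yonedaEquiv_δ] at h
      refine (G.toMfd.stalk_δ_germ _ _).symm.trans (Eq.trans ?_ (G.toMfd.stalk_δ_germ _ _))
      rw [hf, hf]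
      exact h
    obtain ⟨s, hrs, hs⟩ := exists_forall_incl_eq hδ
    have hc : HomCompatible fun (i : Fin (n + 3)) (hi : i ≠ k) =>
        Disk.incl.{u} m hrs ≫ f ⟨i, hi⟩ := by
      refine homCompatible_of_δ fun i j hij hi hj => ?_
      exact hs ⟨⟨⟨i.castSucc, hi⟩, ⟨j, hj⟩⟩, hij⟩
    obtain ⟨z, hz⟩ := G.exists_germ_filler hc
    exact ⟨z, fun i hi => (hz i hi).trans ((germ_incl hrs _).trans (hf ⟨i, hi⟩))⟩

end SimplicialLieGroup

end

theorem mainTheorem9 (G : SimplicialLieGroup.{u}) :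
    IsLieInfinityGroupoid G.toMfd ∧
    (∀ (n : ℕ) (k : Fin (n + 2)),
      ∃ M : MatchingObject (SSet.horn.{0} (n + 1) k : SSet.{0}) G.toMfd,
        SmthMfd.IsSurjSubmersion M.fromSimplex) ∧
    (∀ (n : ℕ) (k : Fin (n + 2))
      (M : MatchingObject (SSet.horn.{0} (n + 2) k.castSucc : SSet.{0}) G.toMfd)
      (N : MatchingObject (SSet.horn.{0} (n + 1) k : SSet.{0}) G.toMfd),
      ∃ D : MatchingObject (SSet.horn.{0} (n + 1) k : SSet.{0}) (dec G.toMfd),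
        IsPullback M.toLastFace (M.toDec k D) N.fromSimplex (D.map N (decTo G.toMfd))) ∧
    (∀ (n : ℕ) (M : MatchingObject (SSet.horn.{0} (n + 1) (Fin.last (n + 1)) : SSet.{0}) G.toMfd),
      ∃ (N : MatchingObject (SSet.horn.{0} (n + 1) 0 : SSet.{0})
          (SimplicialObject.opFunctor.obj G.toMfd)) (e : M.cone.pt ≅ N.cone.pt),
        M.fromSimplex ≫ e.hom = SimplicialObject.opObjIso.inv ≫ N.fromSimplex) ∧
    IsLocallyFibrant G.toMfd := by
  refine ⟨G.isLieInfinityGroupoid, fun n k => ⟨G.hornMatchingObject k,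
    G.isSurjSubmersion_hornMatchingObject k⟩, fun n k M N => ?_,
    fun n M => SimplicialLieGroup.exists_op_matchingObject M, G.isLocallyFibrant⟩
  -- The décalage is again a simplicial Lie group, so its horns also have matching objects.
  let H : SimplicialLieGroup.{u} := joinPoint.op ⋙ G
  exact ⟨H.hornMatchingObject k, SimplicialLieGroup.isPullback_toLastFace M N _⟩
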